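/- **Setting.** Let $S^2=\{(r,z)\in\mathbf R\times\mathbf C : |r|^2+|z|^2=1/4\}$ be the round sphere of radius $1/2$, $\mu$ its area measure normalized to be a probability measure, $PS^2$ the projectivized tangent bundle of $S^2$ (the space of tangent lines), $\pi:PS^2\to S^2$ the projection, and $m=\int m_p\,d\mu(p)$ the normalized Liouville measure on $PS^2$, where $m_p$ is the normalized angular measure on the fibre over $p$. For a diffeomorphism $h$ of $S^2$ let $h_\sharp:PS^2\to PS^2$ be the map induced by the tangent map of $h$. For $\varepsilon>0$ let $f_\varepsilon(r,z)=(r,e^{2\pi i(r+1/2)\varepsilon}z)$ be the twist map. For $\delta>0$ let $U_\delta$ be the ball of radius $\delta$ around the identity of $SO(3)$ for the bi-invariant geodesic metric (distance to the identity $=$ rotation angle), and let $\nu_\delta$ be Haar measure restricted to $U_\delta$ and normalized to be a probability measure. For $g\in SO(3)$ and a probability measure $\kappa$ on $PS^2$ let $P_g\kappa$ be the law of $(u g f_\varepsilon)_\sharp x$, where $u\sim\nu_\delta$ and $x\sim\kappa$ are independent; $\kappa$ is stationary for the $\delta$-diffused process about $gf_\varepsilon$ if $P_g\kappa=\kappa$.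 Let $m_{g,\varepsilon,\delta}$ be the weak limit of the Cesàro averages $\frac1n\sum_{k=1}^n P_g^k m$ as $n\to\infty$, and let $m_{\varepsilon,\delta}=\int_{SO(3)}m_{g,\varepsilon,\delta}\,dg$, where $dg$ is normalized Haar measure. **Theorem.** There is a constant $C>0$ such that for all $\varepsilon,\delta>0$ the following holds. For every $g\in SO(3)$ the measure $m_{g,\varepsilon,\delta}$ exists and is a stationary probability measure of the $\delta$-diffused process about $gf_\varepsilon$ that is absolutely continuous with respect to $m$ and satisfies $\pi_*m_{g,\varepsilon,\delta}=\mu$; the average $m_{\varepsilon,\delta}$ is a probability measure that is absolutely continuous with respect to $m$; and its density $\varphi_{\varepsilon,\delta}=dm_{\varepsilon,\delta}/dm$ satisfies $$\|\varphi_{\varepsilon,\delta}-1\|_{L^1(m)}<C\,\delta^{-11}\,\varepsilon^{-1/2}.$$ In particular, for every fixed $\delta>0$, $m_{\varepsilon,\delta}\to m$ weakly as $\varepsilon\to\infty$. -/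

import Mathlib

open MeasureTheory Filter Topology
open scoped ENNReal BoundedContinuousFunction Matrix

noncomputable section

namespace TwistSphere

/-- Euclidean three-space. The coordinates `(x 0, x 1, x 2)` stand for the point
`(r, z) = (x 0, x 1 + i x 2)` of `ℝ × ℂ`. -/
abbrev E3 : Type := EuclideanSpace ℝ (Fin 3)

/-- The round sphere of radius `1/2`. -/
abbrev S2 : Type := Metric.sphere (0 : E3) (1 / 2)

/-! ### The rotation group -/

/-- The rotation group `SO(3)`, with the topology of the space of matrices. -/
abbrev SO3 : Type := Matrix.specialOrthogonalGroup (Fin 3) ℝ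

instance : MeasurableSpace SO3 := borel SO3

instance : BorelSpace SO3 := ⟨rfl⟩

theorem isCompact_SO3 : IsCompact (Matrix.specialOrthogonalGroup (Fin 3) ℝ : Set
    (Matrix (Fin 3) (Fin 3) ℝ)) := by
  have hsub : (Matrix.specialOrthogonalGroup (Fin 3) ℝ : Set (Matrix (Fin 3) (Fin 3) ℝ)) ⊆
      Set.pi Set.univ (fun _ => Set.pi Set.univ (fun _ => Set.Icc (-1 : ℝ) 1)) := by
    intro A hA i _ j _
    have h1 : A * star A = 1 :=
      (Matrix.mem_orthogonalGroup_iff (Fin 3) ℝ).1 (Matrix.mem_specialOrthogonalGroup_iff.1 hA).1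
    have h2 : ∑ k, A i k * A i k = 1 := by
      have := congrFun (congrFun h1 i) i
      simpa [Matrix.mul_apply, Matrix.star_apply] using this
    have h3 : A i j * A i j ≤ 1 := by
      rw [← h2]
      exact Finset.single_le_sum (f := fun k => A i k * A i k)
        (fun k _ => mul_self_nonneg _) (Finset.mem_univ j)
    exact ⟨by nlinarith, by nlinarith⟩
  have hcl : IsClosed (Matrix.specialOrthogonalGroup (Fin 3) ℝ : Set
      (Matrix (Fin 3) (Fin 3) ℝ)) := by
    have : (Matrix.specialOrthogonalGroup (Fin 3) ℝ : Set (Matrix (Fin 3) (Fin 3) ℝ)) =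
        {A | A * star A = 1} ∩ {A | A.det = 1} := by
      ext A
      simp only [SetLike.mem_coe, Matrix.mem_specialOrthogonalGroup_iff,
        Matrix.mem_orthogonalGroup_iff]
      rfl
    rw [this]
    exact (isClosed_eq (by fun_prop) continuous_const).inter
      (isClosed_eq (Continuous.matrix_det continuous_id) continuous_const)
  exact IsCompact.of_isClosed_subset
    (isCompact_univ_pi fun _ => isCompact_univ_pi fun _ => isCompact_Icc) hcl hsub

instance : CompactSpace SO3 := isCompact_iff_compactSpace.1 isCompact_SO3

instance : IsTopologicalGroup SO3 where
  continuous_inv := by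
    refine Continuous.subtype_mk ?_ _
    exact continuous_star.comp continuous_subtype_val

/-- Haar measure on `SO(3)`, normalized to be a probability measure. -/
def haarSO3 : Measure SO3 := Measure.haarMeasure ⊤

/-- The distance of a rotation to the identity for the bi-invariant geodesic metric of `SO(3)`,
i.e. its rotation angle in `[0, π]`, determined by `tr g = 1 + 2 cos (angle g)`. -/
def rotationAngle (g : SO3) : ℝ :=
  Real.arccos (((g : Matrix (Fin 3) (Fin 3) ℝ).trace - 1) / 2)

/-- The ball `U_δ` of radius `δ` around the identity of `SO(3)`. -/
def rotationBall (δ : ℝ) : Set SO3 := {g | rotationAngle g < δ}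

/-- The restriction of Haar measure to `U_δ`, normalized to be a probability measure. -/
def noise (δ : ℝ) : Measure SO3 := ProbabilityTheory.cond haarSO3 (rotationBall δ)

/-- The rotation of `ℝ³` given by an element of `SO(3)`. -/
def rotate (g : SO3) (x : E3) : E3 :=
  WithLp.toLp 2 ((g : Matrix (Fin 3) (Fin 3) ℝ) *ᵥ x.ofLp)

theorem inner_rotate (g : SO3) (x y : E3) : inner ℝ (rotate g x) (rotate g y) = inner ℝ x y := by
  have h : (g : Matrix (Fin 3) (Fin 3) ℝ)ᵀ * (g : Matrix (Fin 3) (Fin 3) ℝ) = 1 := by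
    have := (Matrix.mem_orthogonalGroup_iff' (Fin 3) ℝ).1
      (Matrix.mem_specialOrthogonalGroup_iff.1 g.2).1
    simpa [Matrix.star_eq_conjTranspose] using this
  simp only [rotate, EuclideanSpace.inner_eq_star_dotProduct, star_trivial]
  rw [Matrix.dotProduct_mulVec, Matrix.vecMul_mulVec, h, Matrix.vecMul_one]

theorem norm_rotate (g : SO3) (x : E3) : ‖rotate g x‖ = ‖x‖ := by
  rw [norm_eq_sqrt_real_inner, inner_rotate, ← norm_eq_sqrt_real_inner]

/-! ### The unit tangent bundle and the projective bundle -/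

/-- The unit tangent bundle `T₁S²`: pairs of a base point `p` and a unit vector `v ⟂ p`. -/
abbrev T1S2 : Type :=
  {x : E3 × E3 // ‖x.1‖ = 1 / 2 ∧ ‖x.2‖ = 1 ∧ inner ℝ x.1 x.2 = 0}

/-- Two unit tangent vectors span the same tangent line. -/
def sameLine : Setoid T1S2 where
  r x y := x.1.1 = y.1.1 ∧ (x.1.2 = y.1.2 ∨ x.1.2 = -y.1.2)
  iseqv :=
    { refl := fun _ => ⟨rfl, Or.inl rfl⟩
      symm := by
        rintro x y ⟨h, h' | h'⟩
        · exact ⟨h.symm, Or.inl h'.symm⟩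
        · exact ⟨h.symm, Or.inr (by rw [h', neg_neg])⟩
      trans := by
        rintro x y z ⟨h, h' | h'⟩ ⟨k, k' | k'⟩
        · exact ⟨h.trans k, Or.inl (h'.trans k')⟩
        · exact ⟨h.trans k, Or.inr (h'.trans k')⟩
        · exact ⟨h.trans k, Or.inr (by rw [h', k'])⟩
        · exact ⟨h.trans k, Or.inl (by rw [h', k', neg_neg])⟩ }

/-- The projective tangent bundle `PS²`, the space of tangent lines of `S²`, with the quotient
topology and its Borel sets. -/
def PS2 : Type := Quotient sameLine

instance : TopologicalSpace PS2 := inferInstanceAs (TopologicalSpace (Quotient sameLine))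

instance : MeasurableSpace PS2 := borel PS2

instance : BorelSpace PS2 := ⟨rfl⟩

/-- The tangent line spanned by a unit tangent vector. -/
def PS2.mk (x : T1S2) : PS2 := Quotient.mk sameLine x

/-- The bundle projection `π : PS² → S²`. -/
def PS2.proj : PS2 → S2 :=
  Quotient.lift (fun x : T1S2 => (⟨x.1.1, by simpa using x.2.1⟩ : S2))
    (fun _ _ h => Subtype.ext h.1)

/-- The unit circle in the tangent plane `T_p S²`, with the metric of `ℝ³`. -/
abbrev TangentCircle (p : S2) : Type := {v : E3 // ‖v‖ = 1 ∧ inner ℝ (p : E3) v = 0}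

/-- The line in `T_p S²` spanned by a unit vector. -/
def tangentLine (p : S2) (v : TangentCircle p) : PS2 :=
  PS2.mk ⟨((p : E3), (v : E3)), by simp, v.2.1, v.2.2⟩

/-- Lebesgue measure `μ` on `S²`: the area, normalized to be a probability measure. -/
def area : Measure S2 := ProbabilityTheory.cond (Measure.hausdorffMeasure 2) Set.univ

/-- The measure `m_p` on the fibre of `PS²` over `p`: arc length on the unit circle of `T_p S²`,
normalized to be a probability measure and transported to lines. -/
def fiberMeasure (p : S2) : Measure PS2 :=
  (ProbabilityTheory.cond (Measure.hausdorffMeasure 1 : Measure (TangentCircle p)) Set.univ).map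
    (tangentLine p)

/-- The normalized Liouville measure on `PS²`: `m = ∫ m_p dμ(p)`. -/
def liouville : Measure PS2 := area.bind fiberMeasure

/-! ### Twist maps and rotations on the projective bundle -/

/-- The twist map `(r, z) ↦ (r, exp (2 π i (r + 1/2) ε) z)`, on all of `ℝ × ℂ`. -/
def twist (ε : ℝ) (x : E3) : E3 :=
  !₂[x 0,
    Real.cos (2 * Real.pi * (x 0 + 1 / 2) * ε) * x 1 -
      Real.sin (2 * Real.pi * (x 0 + 1 / 2) * ε) * x 2,
    Real.sin (2 * Real.pi * (x 0 + 1 / 2) * ε) * x 1 +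
      Real.cos (2 * Real.pi * (x 0 + 1 / 2) * ε) * x 2]

theorem inner_twist_self (ε : ℝ) (x : E3) :
    inner ℝ (twist ε x) (twist ε x) = inner ℝ x x := by
  simp only [twist, PiLp.inner_apply, Fin.sum_univ_three, RCLike.inner_apply, conj_trivial]
  simp [-one_div]
  linear_combination (x 1 ^ 2 + x 2 ^ 2) *
    Real.sin_sq_add_cos_sq (2 * Real.pi * (x 0 + 1 / 2) * ε)

theorem norm_twist (ε : ℝ) (x : E3) : ‖twist ε x‖ = ‖x‖ := by
  rw [norm_eq_sqrt_real_inner, inner_twist_self, ← norm_eq_sqrt_real_inner]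

theorem twist_neg_twist (ε : ℝ) (x : E3) : twist (-ε) (twist ε x) = x := by
  have h := Real.sin_sq_add_cos_sq (2 * Real.pi * (x 0 + 1 / 2) * ε)
  ext i
  fin_cases i
  · simp [twist]
  · simp only [twist, mul_neg]
    simp [-one_div]
    linear_combination (x 1) * h
  · simp only [twist, mul_neg]
    simp [-one_div]
    linear_combination (x 2) * h

theorem differentiable_twist (ε : ℝ) : Differentiable ℝ (twist ε) := by
  rw [differentiable_euclidean]
  intro i
  fin_cases i <;> simp only [twist] <;> simp <;> fun_prop

/-- The derivative of the twist map along `S²` takes tangent vectors at `p` to tangent vectors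
at the image of `p`. -/
theorem inner_fderiv_twist (ε : ℝ) (p v : E3) :
    inner ℝ (twist ε p) (fderiv ℝ (twist ε) p v) = inner ℝ p v := by
  have hd := (differentiable_twist ε p).hasFDerivAt
  have h1 := hd.inner ℝ hd
  have h2 := (hasFDerivAt_id (𝕜 := ℝ) p).inner ℝ (hasFDerivAt_id p)
  have h3 : (fun x => inner ℝ (twist ε x) (twist ε x)) = fun x : E3 => inner ℝ (id x) (id x) := by
    funext x
    exact inner_twist_self ε x
  rw [h3] at h1
  have h4 := congrArg (fun L => L v) (h1.unique h2)
  simp [real_inner_comm] at h4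
  have h5 := real_inner_comm (twist ε p) (fderiv ℝ (twist ε) p v)
  have h6 := real_inner_comm p v
  linarith

theorem fderiv_twist_ne_zero (ε : ℝ) (p : E3) {v : E3} (hv : v ≠ 0) :
    fderiv ℝ (twist ε) p v ≠ 0 := by
  intro h0
  have h1 := ((differentiable_twist (-ε) (twist ε p)).hasFDerivAt).comp p
    (differentiable_twist ε p).hasFDerivAt
  have h2 : (twist (-ε) ∘ twist ε) = (id : E3 → E3) := funext fun x => twist_neg_twist ε x
  rw [h2] at h1
  have h3 := congrArg (fun L => L v) (h1.unique (hasFDerivAt_id p))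
  simp [h0] at h3
  exact hv h3.symm

/-- The map of `T₁S²` induced by the twist map `f`, `(p, v) ↦ (f p, T_p f v / ‖T_p f v‖)`. As `v`
is tangent to `S²`, `T_p f v` is the derivative at `p` in the direction `v` of the twist map of
the ambient space. -/
def twistT1 (ε : ℝ) (x : T1S2) : T1S2 :=
  ⟨(twist ε x.1.1,
      (‖fderiv ℝ (twist ε) x.1.1 x.1.2‖)⁻¹ • fderiv ℝ (twist ε) x.1.1 x.1.2), by
    refine ⟨by simpa only [norm_twist] using x.2.1, ?_, ?_⟩
    · have hv : x.1.2 ≠ 0 := fun h => by simpa [h] using x.2.2.1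
      have := norm_ne_zero_iff.2 (fderiv_twist_ne_zero ε x.1.1 hv)
      simp only [norm_smul, norm_inv, norm_norm]
      exact inv_mul_cancel₀ this
    · simp only [inner_smul_right, inner_fderiv_twist, x.2.2.2, mul_zero]⟩

/-- The map `f_♯` of `PS²` induced by the twist map. -/
def twistSharp (ε : ℝ) : PS2 → PS2 :=
  Quotient.map' (s₁ := sameLine) (s₂ := sameLine) (twistT1 ε) (by
    rintro ⟨⟨p, v⟩, hx⟩ ⟨⟨q, w⟩, hy⟩ ⟨h, h'⟩
    simp only at h h'
    subst h
    refine ⟨rfl, ?_⟩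
    rcases h' with h' | h'
    · subst h'
      exact Or.inl rfl
    · subst h'
      exact Or.inr (by simp [twistT1]))

/-- The action of a rotation on `T₁S²` by its tangent map. -/
def rotateT1 (g : SO3) (x : T1S2) : T1S2 :=
  ⟨(rotate g x.1.1, rotate g x.1.2), by
    simpa only [norm_rotate, inner_rotate] using x.2⟩

/-- The action of a rotation on `PS²` by its tangent map. -/
def rotateSharp (g : SO3) : PS2 → PS2 :=
  Quotient.map' (s₁ := sameLine) (s₂ := sameLine) (rotateT1 g) (by
    rintro ⟨⟨p, v⟩, hx⟩ ⟨⟨q, w⟩, hy⟩ ⟨h, h'⟩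
    simp only at h h'
    subst h
    refine ⟨rfl, ?_⟩
    rcases h' with h' | h'
    · subst h'
      exact Or.inl rfl
    · subst h'
      exact Or.inr (by simp [rotateT1, rotate, Matrix.mulVec_neg]))

/-! ### The `δ`-diffused process and its stationary measures -/

/-- One step of the `δ`-diffused process about `g f_ε` on `PS²`: the law of `(u g f_ε)_♯ x` where
`u` has normalized Haar measure on `U_δ` as its law, and `x` has law `κ` and is independent
of `u`. -/
def step (ε δ : ℝ) (g : SO3) (κ : Measure PS2) : Measure PS2 :=
  ((noise δ).prod κ).map fun a => rotateSharp a.1 (rotateSharp g (twistSharp ε a.2))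

/-- `κ` is a stationary probability measure of the `δ`-diffused process about `g f_ε` that is
absolutely continuous with respect to Liouville measure and covers Lebesgue measure on `S²`. -/
structure IsDiffusedStationary (ε δ : ℝ) (g : SO3) (κ : Measure PS2) : Prop where
  isProbabilityMeasure : IsProbabilityMeasure κ
  stationary : step ε δ g κ = κ
  absolutelyContinuous : κ ≪ liouville
  covers : κ.map PS2.proj = area

/-- The Cesàro average of the first `n` images of Liouville measure under the process. -/
def cesaro (ε δ : ℝ) (g : SO3) (n : ℕ) : Measure PS2 :=
  (n : ℝ≥0∞)⁻¹ • ∑ k ∈ Finset.Icc 1 n, (step ε δ g)^[k] liouville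

/-- `κ` is the weak limit of the Cesàro averages. -/
def IsCesaroLimit (ε δ : ℝ) (g : SO3) (κ : Measure PS2) : Prop :=
  IsProbabilityMeasure κ ∧ ∀ F : PS2 →ᵇ ℝ,
    Tendsto (fun n => ∫ x, F x ∂(cesaro ε δ g n)) atTop (𝓝 (∫ x, F x ∂κ))

open Classical in
/-- The stationary measure `m_{g,ε,δ}`, the weak limit of the Cesàro averages. -/
def diffusedMeasure (ε δ : ℝ) (g : SO3) : Measure PS2 :=
  if h : ∃ κ, IsCesaroLimit ε δ g κ then h.choose else 0

/-- The averaged stationary measure `m_{ε,δ} = ∫ m_{g,ε,δ} dg`. -/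
def averagedMeasure (ε δ : ℝ) : Measure PS2 := haarSO3.bind (diffusedMeasure ε δ)

/-- The density `φ_{ε,δ}` of `m_{ε,δ}` with respect to Liouville measure. -/
def density (ε δ : ℝ) (x : PS2) : ℝ := ((averagedMeasure ε δ).rnDeriv liouville x).toReal

end TwistSphere

end

/-!
Rotations act simply transitively on the unit tangent vectors of the sphere, so that the diffused
process lifts to `SO(3)` by reading a rotation matrix as the frame of a tangent vector, and
Liouville measure is the image of Haar measure.

On frames, the Markov operator of the process maps bounded sets of continuous functions to
equicontinuous ones, so its Cesàro averages converge to a stationary measure. By stationarity the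
limit has density at most `1 / |U_δ|` with respect to Haar measure, and its base point is uniformly
distributed because the twist preserves area.

The twist shears the tangent line of a frame `a` towards the horizontal direction, to within
`(ε |a₀₁ a₀₂|)⁻¹`. The law of a diffused frame is uniform on a translate of `U_δ` and depends on
the frame like the square root of the distance, with constant of order `1 / |U_δ|`. Hence one step
of the process carries the stationary measure to the law obtained from the horizontal line at a
uniformly distributed point, up to `ε^(-1/2) / |U_δ|` times the integral of `|a₀₁ a₀₂|^(-1/2)`
against the stationary measure, which is at most `1 / |U_δ|` times its finite Haar integral. After
averaging over `g` the comparison law is exactly Liouville measure. As `|U_δ|` is of order `δ³`,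
the error is `O(δ⁻⁶ ε^(-1/2))` for `δ ≤ π`, and for `δ > π` it vanishes.
-/

noncomputable section

namespace TwistSphere

/-! ### Measures on homogeneous spaces -/

section HomogeneousSpace

variable {G X : Type*} [Group G] [MeasurableSpace G] [MulAction G X] [MeasurableSpace X]
  [MeasurableSMul₂ G X]

theorem measurable_smul_prod : Measurable fun a : G × X => a.1 • a.2 := measurable_smul

theorem map_smul_prod [MulAction.IsPretransitive G X] [MeasurableMul G] (μ : Measure G) [SFinite μ]
    [μ.IsMulRightInvariant] (ρ : Measure X) [IsProbabilityMeasure ρ] (x₀ : X) :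
    (μ.prod ρ).map (fun a => a.1 • a.2) = μ.map (· • x₀) := by
  ext B hB
  have hB₂ : MeasurableSet ((fun a : G × X => a.1 • a.2) ⁻¹' B) := measurable_smul_prod hB
  have hfiber : ∀ x : X, μ ((fun g => (g, x)) ⁻¹' ((fun a : G × X => a.1 • a.2) ⁻¹' B)) =
      μ ((· • x₀) ⁻¹' B) := by
    intro x
    obtain ⟨c, rfl⟩ := MulAction.exists_smul_eq G x₀ x
    rw [← measure_preimage_mul_right μ c ((· • x₀) ⁻¹' B)]
    simp only [← Set.preimage_comp, Function.comp_def, smul_smul]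
  rw [Measure.map_apply measurable_smul_prod hB, Measure.map_apply (measurable_smul_const x₀) hB,
    Measure.prod_apply_symm hB₂]
  simp only [hfiber, lintegral_const, measure_univ, mul_one]

theorem map_smul_prod_of_smulInvariant (μ : Measure G) [IsProbabilityMeasure μ] (ρ : Measure X)
    [SFinite ρ] [SMulInvariantMeasure G X ρ] : (μ.prod ρ).map (fun a => a.1 • a.2) = ρ := by
  ext B hB
  have hB₂ : MeasurableSet ((fun a : G × X => a.1 • a.2) ⁻¹' B) := measurable_smul_prod hB
  have hfiber : ∀ g : G, ρ (Prod.mk g ⁻¹' ((fun a : G × X => a.1 • a.2) ⁻¹' B)) = ρ B :=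
    fun g => measure_preimage_smul_of_nullMeasurableSet hB.nullMeasurableSet g
  rw [Measure.map_apply measurable_smul_prod hB, Measure.prod_apply hB₂]
  simp only [hfiber, lintegral_const, measure_univ, mul_one]

theorem eq_map_smul_of_smulInvariant [MulAction.IsPretransitive G X] [MeasurableMul G]
    (μ : Measure G) [IsProbabilityMeasure μ] [μ.IsMulRightInvariant] (ρ : Measure X)
    [IsProbabilityMeasure ρ] [SMulInvariantMeasure G X ρ] (x₀ : X) : ρ = μ.map (· • x₀) := by
  rw [← map_smul_prod μ ρ x₀, map_smul_prod_of_smulInvariant]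

/-- Replace the point `x` by `h • x` with `h` uniformly distributed and independent of `x`: then
`τ` does not change, and `τ x * h` is again uniformly distributed. -/
theorem map_smul_self_of_smulInvariant [MeasurableMul G] (μ : Measure G) [IsProbabilityMeasure μ]
    [μ.IsMulLeftInvariant] (ρ : Measure X) [SFinite ρ] [SMulInvariantMeasure G X ρ] {τ : X → G}
    (hτ : Measurable τ) (hinv : ∀ (g : G) (x : X), τ (g • x) = τ x) :
    ρ.map (fun x => τ x • x) = ρ := by
  have hmeas : Measurable fun x => τ x • x := hτ.smul measurable_id
  ext B hB
  have hB₂ : MeasurableSet ((fun a : G × X => a.1 • a.2) ⁻¹' B) := measurable_smul_prod hB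
  have hfiber : ∀ x : X, μ {g | τ x • g • x ∈ B} = μ {g | g • x ∈ B} := fun x => by
    simp only [smul_smul]
    exact measure_preimage_mul μ (τ x) {g | g • x ∈ B}
  calc ρ.map (fun x => τ x • x) B
      = (μ.prod ρ).map (fun a => a.1 • a.2) ((fun x => τ x • x) ⁻¹' B) := by
        rw [map_smul_prod_of_smulInvariant, Measure.map_apply hmeas hB]
    _ = ∫⁻ x, μ {g | τ x • g • x ∈ B} ∂ρ := by
        rw [Measure.map_apply measurable_smul_prod (hmeas hB),
          Measure.prod_apply_symm (measurable_smul_prod (hmeas hB))]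
        simp only [Set.preimage, Set.mem_ofPred_eq, hinv]
    _ = ∫⁻ x, μ {g | g • x ∈ B} ∂ρ := by simp only [hfiber]
    _ = (μ.prod ρ).map (fun a => a.1 • a.2) B := by
        rw [Measure.map_apply measurable_smul_prod hB, Measure.prod_apply_symm hB₂]
        rfl
    _ = ρ B := by rw [map_smul_prod_of_smulInvariant]

end HomogeneousSpace

/-! ### Hausdorff measure -/

theorem map_cond_univ {X Y : Type*} [MeasurableSpace X] [MeasurableSpace Y] {μ : Measure X}
    {f : X → Y} (hf : Measurable f) :
    (ProbabilityTheory.cond μ Set.univ).map f = ProbabilityTheory.cond (μ.map f) Set.univ := by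
  simp [ProbabilityTheory.cond, Measure.map_smul, Measure.map_apply hf]

theorem hausdorffMeasure_univ_lt_top_of_lipschitzOnWith {X Y : Type*} [EMetricSpace X]
    [EMetricSpace Y] [MeasurableSpace X] [BorelSpace X] [MeasurableSpace Y] [BorelSpace Y]
    {f : X → Y} {K : NNReal} {s : Set X} {d : ℝ} (hd : 0 ≤ d) (hf : LipschitzOnWith K f s)
    (hs : Measure.hausdorffMeasure d s < ∞) (himage : f '' s = Set.univ) :
    (Measure.hausdorffMeasure d : Measure Y) Set.univ < ∞ := by
  rw [← himage]
  exact (hf.hausdorffMeasure_image_le hd).trans_lt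
    (ENNReal.mul_lt_top (ENNReal.rpow_lt_top_of_nonneg hd ENNReal.coe_ne_top) hs)

theorem hausdorffMeasure_univ_pos_of_lipschitzWith {X Y : Type*} [EMetricSpace X]
    [EMetricSpace Y] [MeasurableSpace X] [BorelSpace X] [MeasurableSpace Y] [BorelSpace Y]
    {f : X → Y} {K : NNReal} {t : Set Y} {d : ℝ} (hd : 0 ≤ d) (hf : LipschitzWith K f)
    (ht : 0 < Measure.hausdorffMeasure d t) (hrange : t ⊆ Set.range f) :
    0 < (Measure.hausdorffMeasure d : Measure X) Set.univ := by
  have hle := (hf.lipschitzOnWith (s := Set.univ)).hausdorffMeasure_image_le hd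
  rw [Set.image_univ] at hle
  exact pos_of_mul_pos_right ((ht.trans_le (measure_mono hrange)).trans_le hle) zero_le

/-! ### The rotation group -/

theorem adjugate_eq_of_mul_eq_one {n R : Type*} [Fintype n] [DecidableEq n] [CommRing R]
    {A B : Matrix n n R} (h : A * B = 1) (hdet : A.det = 1) : A.adjugate = B := by
  rw [← Matrix.inv_eq_right_inv h, Matrix.inv_def, hdet, Ring.inverse_one, one_smul]

/-- The matrix of a rotation. -/
abbrev mat (g : SO3) : Matrix (Fin 3) (Fin 3) ℝ := g

instance : SecondCountableTopology SO3 :=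
  have : SecondCountableTopology (Matrix (Fin 3) (Fin 3) ℝ) :=
    inferInstanceAs (SecondCountableTopology (Fin 3 → Fin 3 → ℝ))
  TopologicalSpace.Subtype.secondCountableTopology _

instance : TopologicalSpace.MetrizableSpace SO3 :=
  TopologicalSpace.metrizableSpace_of_t3_secondCountable SO3

instance : haarSO3.IsHaarMeasure := Measure.isHaarMeasure_haarMeasure _

instance : IsProbabilityMeasure haarSO3 :=
  ⟨by rw [haarSO3, ← TopologicalSpace.PositiveCompacts.coe_top, Measure.haarMeasure_self]⟩

instance : haarSO3.IsMulRightInvariant where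
  map_mul_right_eq_self g :=
    have : IsProbabilityMeasure (haarSO3.map (· * g)) :=
      Measure.isProbabilityMeasure_map (measurable_mul_const g).aemeasurable
    Measure.isHaarMeasure_eq_of_isProbabilityMeasure _ _

theorem mat_mul (g h : SO3) : mat (g * h) = mat g * mat h := rfl

theorem mat_inv (g : SO3) : mat g⁻¹ = (mat g)ᵀ := rfl

theorem mat_mul_transpose (g : SO3) : mat g * (mat g)ᵀ = 1 := by
  rw [← mat_inv, ← mat_mul, mul_inv_cancel]
  rfl

theorem mat_transpose_mul (g : SO3) : (mat g)ᵀ * mat g = 1 := by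
  rw [← mat_inv, ← mat_mul, inv_mul_cancel]
  rfl

theorem mat_det (g : SO3) : (mat g).det = 1 := (Matrix.mem_specialOrthogonalGroup_iff.1 g.2).2

theorem continuous_mat : Continuous mat := continuous_subtype_val

theorem continuous_entry (i j : Fin 3) : Continuous fun g : SO3 => mat g i j :=
  continuous_mat.matrix_elem i j

theorem row_inner (g : SO3) (i j : Fin 3) :
    mat g i 0 * mat g j 0 + mat g i 1 * mat g j 1 + mat g i 2 * mat g j 2 =
      if i = j then 1 else 0 := by
  have := congrFun (congrFun (mat_mul_transpose g) i) j
  simpa [Matrix.mul_apply, Fin.sum_univ_three, Matrix.one_apply] using this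

theorem col_inner (g : SO3) (i j : Fin 3) :
    mat g 0 i * mat g 0 j + mat g 1 i * mat g 1 j + mat g 2 i * mat g 2 j =
      if i = j then 1 else 0 := by
  have := congrFun (congrFun (mat_transpose_mul g) i) j
  simpa [Matrix.mul_apply, Fin.sum_univ_three, Matrix.one_apply] using this

theorem abs_entry_le_one (g : SO3) (i j : Fin 3) : |mat g i j| ≤ 1 :=
  entry_norm_bound_of_unitary (Matrix.mem_specialOrthogonalGroup_iff.1 g.2).1 i j

theorem adjugate_mat (g : SO3) : (mat g).adjugate = (mat g)ᵀ :=
  adjugate_eq_of_mul_eq_one (mat_mul_transpose g) (mat_det g)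

theorem col_two (g : SO3) :
    mat g 0 2 = mat g 1 0 * mat g 2 1 - mat g 2 0 * mat g 1 1 ∧
    mat g 1 2 = mat g 2 0 * mat g 0 1 - mat g 0 0 * mat g 2 1 ∧
    mat g 2 2 = mat g 0 0 * mat g 1 1 - mat g 1 0 * mat g 0 1 := by
  have h := (Matrix.adjugate_fin_three (mat g)).symm.trans (adjugate_mat g)
  have h0 := congrFun (congrFun h 2) 0
  have h1 := congrFun (congrFun h 2) 1
  have h2 := congrFun (congrFun h 2) 2
  simp only [Matrix.of_apply, Matrix.cons_val, Matrix.transpose_apply] at h0 h1 h2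
  exact ⟨by linarith, by linarith, by linarith⟩

theorem entry_zero_zero (g : SO3) :
    mat g 0 0 = mat g 1 1 * mat g 2 2 - mat g 1 2 * mat g 2 1 := by
  have h := (Matrix.adjugate_fin_three (mat g)).symm.trans (adjugate_mat g)
  have h0 := congrFun (congrFun h 0) 0
  simp only [Matrix.of_apply, Matrix.cons_val, Matrix.transpose_apply] at h0
  linarith

/-! ### Rotations of space -/

theorem norm_sq_E3 (x : E3) : ‖x‖ ^ 2 = x 0 ^ 2 + x 1 ^ 2 + x 2 ^ 2 := by
  simp [EuclideanSpace.norm_sq_eq, Fin.sum_univ_three]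

theorem inner_E3 (x y : E3) : inner ℝ x y = x 0 * y 0 + x 1 * y 1 + x 2 * y 2 := by
  simp [PiLp.inner_apply, Fin.sum_univ_three, mul_comm]

theorem rotate_mul (g h : SO3) (x : E3) : rotate (g * h) x = rotate g (rotate h x) := by
  simp [rotate, Matrix.mulVec_mulVec]

theorem rotate_one (x : E3) : rotate 1 x = x := by simp [rotate]

theorem rotate_apply (g : SO3) (x : E3) (i : Fin 3) :
    rotate g x i = mat g i 0 * x 0 + mat g i 1 * x 1 + mat g i 2 * x 2 := by
  simp [rotate, Matrix.mulVec, dotProduct, Fin.sum_univ_three]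

theorem rotate_smul (g : SO3) (c : ℝ) (x : E3) : rotate g (c • x) = c • rotate g x := by
  simp [rotate, Matrix.mulVec_smul]

theorem continuous_rotate : Continuous fun a : SO3 × E3 => rotate a.1 a.2 := by
  unfold rotate
  refine (PiLp.continuous_toLp 2 _).comp ?_
  exact Continuous.matrix_mulVec (continuous_mat.comp continuous_fst)
    ((PiLp.continuous_ofLp 2 _).comp continuous_snd)

/-- A rotation as a linear isometry of space. -/
def rotateLinear (g : SO3) : E3 ≃ₗᵢ[ℝ] E3 where
  toFun := rotate g
  invFun := rotate g⁻¹
  left_inv x := by rw [← rotate_mul g⁻¹ g x, inv_mul_cancel, rotate_one]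
  right_inv x := by rw [← rotate_mul g g⁻¹ x, mul_inv_cancel, rotate_one]
  map_add' x y := by simp [rotate, Matrix.mulVec_add]
  map_smul' := rotate_smul g
  norm_map' := norm_rotate g

/-! ### The actions on the sphere, on unit tangent vectors and on tangent lines -/

instance : MulAction SO3 S2 where
  smul g p := ⟨rotate g p, by rw [mem_sphere_zero_iff_norm, norm_rotate, norm_eq_of_mem_sphere]⟩
  one_smul p := Subtype.ext (rotate_one p)
  mul_smul g h p := Subtype.ext (rotate_mul g h p)

instance : MulAction SO3 T1S2 where
  smul := rotateT1
  one_smul x := Subtype.ext (Prod.ext (rotate_one x.1.1) (rotate_one x.1.2))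
  mul_smul g h x := Subtype.ext (Prod.ext (rotate_mul g h x.1.1) (rotate_mul g h x.1.2))

theorem mk_surjective : Function.Surjective PS2.mk := Quotient.mk_surjective

instance : MulAction SO3 PS2 where
  smul := rotateSharp
  one_smul x := by
    obtain ⟨x, rfl⟩ := mk_surjective x
    exact congrArg PS2.mk (one_smul SO3 x)
  mul_smul g h x := by
    obtain ⟨x, rfl⟩ := mk_surjective x
    exact congrArg PS2.mk (mul_smul g h x)

theorem coe_smul (g : SO3) (p : S2) : ((g • p : S2) : E3) = rotate g p := rfl

theorem rotateSharp_eq_smul (g : SO3) (x : PS2) : rotateSharp g x = g • x := rfl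

instance : ContinuousSMul SO3 S2 where
  continuous_smul := (continuous_rotate.comp
    (continuous_fst.prodMk (continuous_subtype_val.comp continuous_snd))).subtype_mk _

instance : ContinuousSMul SO3 T1S2 where
  continuous_smul :=
    have hval := continuous_subtype_val.comp (continuous_snd (X := SO3) (Y := T1S2))
    ((continuous_rotate.comp (continuous_fst.prodMk (continuous_fst.comp hval))).prodMk
      (continuous_rotate.comp (continuous_fst.prodMk (continuous_snd.comp hval)))).subtype_mk _

instance : IsIsometricSMul SO3 S2 where
  isometry_smul g := Isometry.of_dist_eq fun p q => (rotateLinear g).dist_map p q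

/-! ### Frames -/

/-- The first standard basis vector, which spans the axis of the twist maps. -/
def e0 : E3 := !₂[1, 0, 0]

/-- The second standard basis vector, the tangent direction chosen at the pole. -/
def e1 : E3 := !₂[0, 1, 0]

/-- The reference unit tangent vector: every unit tangent vector is its image under a unique
rotation. -/
def poleVector : T1S2 :=
  ⟨((1 / 2 : ℝ) • e0, e1), by simp [e0, norm_smul, EuclideanSpace.norm_eq, Fin.sum_univ_three],
    by simp [e1, EuclideanSpace.norm_eq, Fin.sum_univ_three], by simp [inner_E3, e0, e1]⟩

/-- The pole of the axis of the twist maps. -/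
def pole : S2 := (PS2.mk poleVector).proj

/-- The unit tangent vector given by the first two vectors of the frame `g`: the columns of a
rotation matrix are read as an oriented orthonormal frame. -/
def frameVector (g : SO3) : T1S2 := g • poleVector

/-- The line of the second vector of a frame, at the point given by the first one. -/
def frameLine (g : SO3) : PS2 := g • PS2.mk poleVector

/-- The base point of a frame. -/
def framePoint (g : SO3) : S2 := g • pole

theorem frameVector_fst_apply (g : SO3) (i : Fin 3) : (frameVector g).1.1 i = mat g i 0 / 2 := by
  change rotate g ((1 / 2 : ℝ) • e0) i = _
  simp [rotate_apply, e0]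
  ring

theorem frameVector_snd_apply (g : SO3) (i : Fin 3) : (frameVector g).1.2 i = mat g i 1 := by
  change rotate g e1 i = _
  simp [rotate_apply, e1]

theorem mk_frameVector (g : SO3) : PS2.mk (frameVector g) = frameLine g := rfl

/-- The matrix with columns `2 p`, `v`, `2 p × v`. -/
def frameMat (p v : E3) : Matrix (Fin 3) (Fin 3) ℝ :=
  !![2 * p 0, v 0, 2 * (p 1 * v 2 - p 2 * v 1);
     2 * p 1, v 1, 2 * (p 2 * v 0 - p 0 * v 2);
     2 * p 2, v 2, 2 * (p 0 * v 1 - p 1 * v 0)]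

theorem frameMat_mem {p v : E3} (hp : ‖p‖ = 1 / 2) (hv : ‖v‖ = 1) (hpv : inner ℝ p v = 0) :
    frameMat p v ∈ Matrix.specialOrthogonalGroup (Fin 3) ℝ := by
  have hp' := norm_sq_E3 p
  have hv' := norm_sq_E3 v
  rw [inner_E3] at hpv
  rw [hp] at hp'
  rw [hv] at hv'
  have hcross : (p 1 * v 2 - p 2 * v 1) ^ 2 + (p 2 * v 0 - p 0 * v 2) ^ 2 +
      (p 0 * v 1 - p 1 * v 0) ^ 2 = 1 / 4 := by
    linear_combination -(v 0 ^ 2 + v 1 ^ 2 + v 2 ^ 2) * hp' - 1 / 4 * hv' -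
      (p 0 * v 0 + p 1 * v 1 + p 2 * v 2) * hpv
  rw [Matrix.mem_specialOrthogonalGroup_iff, Matrix.mem_orthogonalGroup_iff']
  constructor
  · ext i j
    fin_cases i <;> fin_cases j <;>
      simp only [frameMat, Matrix.mul_apply, Fin.sum_univ_three, Matrix.transpose_apply,
        Matrix.one_apply, Matrix.of_apply, Matrix.cons_val, Matrix.cons_val', Fin.zero_eta,
        Fin.mk_one, Fin.reduceFinMk, Fin.reduceEq, Fin.isValue, zero_ne_one, one_ne_zero, if_true,
        if_false] <;>
      first
      | linear_combination -4 * hp'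
      | linear_combination -hv'
      | linear_combination 4 * hcross
      | linear_combination 2 * hpv
      | ring
  · simp only [Matrix.det_fin_three, frameMat, Matrix.of_apply, Matrix.cons_val]
    linear_combination 4 * hcross

/-- The oriented orthonormal frame determined by a unit tangent vector. -/
def frame (x : T1S2) : SO3 := ⟨frameMat x.1.1 x.1.2, frameMat_mem x.2.1 x.2.2.1 x.2.2.2⟩

theorem mat_frame (x : T1S2) : mat (frame x) = frameMat x.1.1 x.1.2 := rfl

theorem frameVector_frame (x : T1S2) : frameVector (frame x) = x := by
  refine Subtype.ext (Prod.ext ?_ ?_) <;> ext i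
  · rw [frameVector_fst_apply]
    fin_cases i <;> simp [mat_frame, frameMat]
  · rw [frameVector_snd_apply]
    fin_cases i <;> simp [mat_frame, frameMat]

theorem continuous_frameVector : Continuous frameVector := continuous_id.smul continuous_const

theorem continuous_frame : Continuous frame := by
  refine Continuous.subtype_mk (continuous_matrix fun i j => ?_) _
  fin_cases i <;> fin_cases j <;> simp only [frameMat, Matrix.of_apply, Matrix.cons_val,
    Fin.zero_eta, Fin.mk_one, Fin.reduceFinMk] <;> fun_prop

theorem frameVector_surjective : Function.Surjective frameVector :=
  Function.RightInverse.surjective frameVector_frame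

theorem frameLine_surjective : Function.Surjective frameLine :=
  mk_surjective.comp frameVector_surjective

instance : MulAction.IsPretransitive SO3 PS2 :=
  (MulAction.isPretransitive_iff_base (PS2.mk poleVector)).2 frameLine_surjective

instance : CompactSpace T1S2 where
  isCompact_univ := frameVector_surjective.range_eq ▸ isCompact_range continuous_frameVector

theorem framePoint_frame (x : T1S2) : (framePoint (frame x) : E3) = x.1.1 :=
  congrArg (fun y : T1S2 => y.1.1) (frameVector_frame x)

/-! ### The topology of the projective bundle -/

theorem continuous_mk : Continuous PS2.mk := continuous_quotient_mk'

theorem continuous_frameLine : Continuous frameLine := continuous_mk.comp continuous_frameVector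

theorem continuous_framePoint : Continuous framePoint := continuous_id.smul continuous_const

theorem continuous_proj : Continuous PS2.proj :=
  Continuous.quotient_lift (Continuous.subtype_mk (continuous_fst.comp continuous_subtype_val) _) _

instance : CompactSpace PS2 := inferInstanceAs (CompactSpace (Quotient sameLine))

theorem eq_or_eq_neg_of_forall_mul_eq {ι : Type*} [Fintype ι] {v w : EuclideanSpace ℝ ι}
    (hv : ‖v‖ = 1) (hw : ‖w‖ = 1) (h : ∀ i j, v i * v j = w i * w j) : v = w ∨ v = -w := by
  have hsum : ∑ j, v j * v j = 1 := by
    rw [← one_pow 2, ← hv, EuclideanSpace.real_norm_sq_eq]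
    exact Finset.sum_congr rfl fun j _ => (sq (v j)).symm
  have hsmul : v = inner ℝ w v • w := by
    ext i
    calc v i = ∑ j, v i * (v j * v j) := by rw [← Finset.mul_sum, hsum, mul_one]
      _ = ∑ j, v j * w j * w i := Finset.sum_congr rfl fun j _ => by
          linear_combination v j * h i j
      _ = inner ℝ w v * w i := by rw [← Finset.sum_mul]; rfl
  have habs : |inner ℝ w v| = 1 := by
    rw [← Real.norm_eq_abs, ← mul_one ‖inner ℝ w v‖, ← hw, ← norm_smul, ← hsmul, hv, hw]
  rcases (abs_eq zero_le_one).1 habs with hc | hc <;> rw [hc] at hsmul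
  · exact Or.inl (by simpa only [one_smul] using hsmul)
  · exact Or.inr (by simpa only [neg_smul, one_smul] using hsmul)

/-- The base point of a tangent line together with the matrix `v vᵀ` of the orthogonal projection
to the line. It embeds `PS²` into a Euclidean space. -/
def lineProjector : PS2 → E3 × (Fin 3 → Fin 3 → ℝ) :=
  Quotient.lift (fun x : T1S2 => (x.1.1, fun i j => x.1.2 i * x.1.2 j)) (by
    rintro x y ⟨h, h' | h'⟩ <;> simp [h, h'])

theorem continuous_lineProjector : Continuous lineProjector := by
  refine Continuous.quotient_lift ?_ _
  fun_prop

theorem lineProjector_injective : Function.Injective lineProjector := by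
  intro x y h
  obtain ⟨x, rfl⟩ := mk_surjective x
  obtain ⟨y, rfl⟩ := mk_surjective y
  obtain ⟨hbase, hproj⟩ := Prod.mk.inj h
  exact Quotient.sound ⟨hbase, eq_or_eq_neg_of_forall_mul_eq x.2.2.1 y.2.2.1 fun i j =>
    congrFun (congrFun hproj i) j⟩

instance : T2Space PS2 :=
  T2Space.of_injective_continuous lineProjector_injective continuous_lineProjector

instance : SecondCountableTopology PS2 :=
  (continuous_lineProjector.isClosedEmbedding
    lineProjector_injective).isEmbedding.secondCountableTopology

instance : TopologicalSpace.MetrizableSpace PS2 :=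
  TopologicalSpace.metrizableSpace_of_t3_secondCountable PS2

instance : ContinuousSMul SO3 PS2 where
  continuous_smul := by
    have hq : IsQuotientMap (Prod.map (id : SO3 → SO3) frameLine) :=
      IsQuotientMap.of_surjective_continuous
        (Function.surjective_id.prodMap frameLine_surjective)
        (continuous_id.prodMap continuous_frameLine)
    rw [hq.continuous_iff]
    have hlift : (fun a : SO3 × PS2 => a.1 • a.2) ∘ Prod.map id frameLine =
        fun a : SO3 × SO3 => frameLine (a.1 * a.2) :=
      funext fun a => smul_smul a.1 a.2 (PS2.mk poleVector)
    rw [hlift]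
    exact continuous_frameLine.comp continuous_mul

/-! ### The twist map on frames -/

theorem contDiff_twist (ε : ℝ) : ContDiff ℝ 1 (twist ε) := by
  rw [contDiff_euclidean]
  intro i
  fin_cases i <;> simp only [twist, Matrix.cons_val, Fin.zero_eta, Fin.mk_one,
    Fin.reduceFinMk] <;> fun_prop

theorem continuous_twistT1 (ε : ℝ) : Continuous (twistT1 ε) := by
  have hderiv : Continuous fun x : T1S2 => fderiv ℝ (twist ε) x.1.1 x.1.2 :=
    ((contDiff_twist ε).continuous_fderiv_apply one_ne_zero).comp continuous_subtype_val
  have hne (x : T1S2) : ‖fderiv ℝ (twist ε) x.1.1 x.1.2‖ ≠ 0 := by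
    have hv : x.1.2 ≠ 0 := norm_ne_zero_iff.1 (x.2.2.1.trans_ne one_ne_zero)
    exact norm_ne_zero_iff.2 (fderiv_twist_ne_zero ε x.1.1 hv)
  exact (((contDiff_twist ε).continuous.comp (continuous_fst.comp continuous_subtype_val)).prodMk
    ((hderiv.norm.inv₀ hne).smul hderiv)).subtype_mk _

theorem twistSharp_mk (ε : ℝ) (x : T1S2) : twistSharp ε (PS2.mk x) = PS2.mk (twistT1 ε x) := rfl

theorem continuous_twistSharp (ε : ℝ) : Continuous (twistSharp ε) :=
  Continuous.quotient_map' (continuous_twistT1 ε) _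

/-- The action of the twist map on frames. -/
def twistFrame (ε : ℝ) (g : SO3) : SO3 := frame (twistT1 ε (frameVector g))

theorem continuous_twistFrame (ε : ℝ) : Continuous (twistFrame ε) :=
  continuous_frame.comp ((continuous_twistT1 ε).comp continuous_frameVector)

theorem frameLine_twistFrame (ε : ℝ) (g : SO3) :
    frameLine (twistFrame ε g) = twistSharp ε (frameLine g) := by
  rw [← mk_frameVector, ← mk_frameVector, twistFrame, frameVector_frame, twistSharp_mk]

/-! ### Horizontal vectors -/

/-- The unit vector at `x` tangent to the circle of rotation about the first axis. On the axis,
where that circle is a point, it is the fixed vector `e1`. -/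
def horizontal (x : E3) : E3 :=
  if x 1 = 0 ∧ x 2 = 0 then e1 else (√(x 1 ^ 2 + x 2 ^ 2))⁻¹ • !₂[0, -x 2, x 1]

theorem measurable_horizontal : Measurable horizontal :=
  Measurable.ite ((measurableSet_eq_fun (by fun_prop) measurable_const).inter
    (measurableSet_eq_fun (by fun_prop) measurable_const)) measurable_const (by fun_prop)

theorem norm_horizontal (x : E3) : ‖horizontal x‖ = 1 := by
  unfold horizontal
  split_ifs with hx
  · exact poleVector.2.2.1
  · have hpos : 0 < x 1 ^ 2 + x 2 ^ 2 := by
      rcases not_and_or.1 hx with h | h <;> positivity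
    have hnorm : ‖(!₂[0, -x 2, x 1] : E3)‖ = √(x 1 ^ 2 + x 2 ^ 2) := by
      simp [EuclideanSpace.norm_eq, Fin.sum_univ_three, add_comm]
    rw [norm_smul, hnorm, norm_inv, Real.norm_of_nonneg (Real.sqrt_nonneg _),
      inv_mul_cancel₀ (Real.sqrt_pos.2 hpos).ne']

theorem inner_horizontal (x : E3) : inner ℝ x (horizontal x) = 0 := by
  unfold horizontal
  split_ifs with hx
  · simp [inner_E3, e1, hx.1]
  · have horth : inner ℝ x (!₂[0, -x 2, x 1] : E3) = 0 := by
      simp only [inner_E3, Matrix.cons_val]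
      ring
    rw [inner_smul_right, horth, mul_zero]

/-- The horizontal unit tangent vector at a point of the sphere. -/
def horizontalVector (p : S2) : T1S2 :=
  ⟨((p : E3), horizontal p), by simp, norm_horizontal _, inner_horizontal _⟩

theorem measurable_horizontalVector : Measurable horizontalVector :=
  (measurable_subtype_coe.prodMk (measurable_horizontal.comp measurable_subtype_coe)).subtype_mk

theorem framePoint_surjective : Function.Surjective framePoint := fun p =>
  ⟨frame (horizontalVector p), Subtype.ext (framePoint_frame _)⟩

instance : MulAction.IsPretransitive SO3 S2 :=
  (MulAction.isPretransitive_iff_base pole).2 framePoint_surjective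

theorem exists_rotate_e0 (x : E3) : ∃ g : SO3, x = ‖x‖ • rotate g e0 := by
  rcases eq_or_ne x 0 with rfl | hx
  · exact ⟨1, by simp⟩
  have hx' : ‖x‖ ≠ 0 := norm_ne_zero_iff.2 hx
  obtain ⟨g, hg⟩ := framePoint_surjective ⟨((1 / 2) * ‖x‖⁻¹) • x, by simp [norm_smul, hx']⟩
  have h : rotate g ((1 / 2 : ℝ) • e0) = ((1 / 2) * ‖x‖⁻¹) • x := congrArg Subtype.val hg
  refine ⟨g, ?_⟩
  rw [rotate_smul, mul_smul] at h
  rw [smul_right_injective E3 (by norm_num : (1 / 2 : ℝ) ≠ 0) h, smul_inv_smul₀ hx']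

/-! ### Area -/

theorem exists_polar (a b : ℝ) : ∃ t ∈ Set.Icc (-Real.pi) Real.pi,
    a = √(a ^ 2 + b ^ 2) * Real.cos t ∧ b = √(a ^ 2 + b ^ 2) * Real.sin t := by
  refine ⟨Complex.arg ⟨a, b⟩, ⟨(Complex.neg_pi_lt_arg _).le, Complex.arg_le_pi _⟩, ?_⟩
  rw [← Complex.norm_eq_sqrt_sq_add_sq ⟨a, b⟩, Complex.norm_mul_cos_arg, Complex.norm_mul_sin_arg]
  exact ⟨rfl, rfl⟩

theorem exists_cos_sin {a b : ℝ} (h : a ^ 2 + b ^ 2 = 1) :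
    ∃ t ∈ Set.Icc (-Real.pi) Real.pi, Real.cos t = a ∧ Real.sin t = b := by
  obtain ⟨t, ht, ha, hb⟩ := exists_polar a b
  rw [h, Real.sqrt_one, one_mul] at ha hb
  exact ⟨t, ht, ha.symm, hb.symm⟩

theorem norm_sq_S2 (p : S2) : (p : E3) 0 ^ 2 + (p : E3) 1 ^ 2 + (p : E3) 2 ^ 2 = 1 / 4 := by
  rw [← norm_sq_E3, norm_eq_of_mem_sphere]
  norm_num

theorem mem_S2_of_sq_add_sq_add_sq {a b c : ℝ} (h : a ^ 2 + b ^ 2 + c ^ 2 = 1 / 4) :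
    !₂[a, b, c] ∈ Metric.sphere (0 : E3) (1 / 2) := by
  rw [mem_sphere_zero_iff_norm, ← sq_eq_sq₀ (norm_nonneg _) (by norm_num), norm_sq_E3]
  simp only [Matrix.cons_val]
  linarith

/-- Spherical coordinates: the angle to the first axis, and the angle of rotation about it. -/
def spherical (x : ℝ × ℝ) : S2 :=
  ⟨!₂[Real.cos x.1 / 2, Real.sin x.1 * Real.cos x.2 / 2, Real.sin x.1 * Real.sin x.2 / 2],
    mem_S2_of_sq_add_sq_add_sq (by
      linear_combination (1 / 4 : ℝ) * Real.sin_sq_add_cos_sq x.1 +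
        (1 / 4 : ℝ) * Real.sin x.1 ^ 2 * Real.sin_sq_add_cos_sq x.2)⟩

theorem contDiff_coe_spherical : ContDiff ℝ 1 fun x => (spherical x : E3) := by
  rw [contDiff_euclidean]
  intro i
  fin_cases i <;> simp only [spherical, Matrix.cons_val, Fin.zero_eta, Fin.mk_one,
    Fin.reduceFinMk] <;> fun_prop

theorem image_spherical :
    spherical '' (Set.Icc (-Real.pi) Real.pi ×ˢ Set.Icc (-Real.pi) Real.pi) = Set.univ := by
  refine Set.eq_univ_of_forall fun p => ?_
  have hp := norm_sq_S2 p
  obtain ⟨s, hs, h1, h2⟩ := exists_polar ((p : E3) 1) ((p : E3) 2)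
  have hr := Real.sq_sqrt (show 0 ≤ (p : E3) 1 ^ 2 + (p : E3) 2 ^ 2 by positivity)
  set r := √((p : E3) 1 ^ 2 + (p : E3) 2 ^ 2)
  obtain ⟨t, ht, hcos, hsin⟩ := exists_cos_sin (a := 2 * (p : E3) 0) (b := 2 * r) (by
    rw [mul_pow, mul_pow, hr]; linarith)
  refine ⟨(t, s), ⟨ht, hs⟩, Subtype.ext ?_⟩
  ext i
  fin_cases i <;> simp only [spherical, hcos, hsin, Matrix.cons_val, Fin.zero_eta, Fin.mk_one,
    Fin.reduceFinMk] <;> linarith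

theorem hausdorffMeasure_S2_lt_top :
    (Measure.hausdorffMeasure 2 : Measure S2) Set.univ < ∞ := by
  have hcompact : IsCompact (Set.Icc (-Real.pi) Real.pi ×ˢ Set.Icc (-Real.pi) Real.pi) :=
    isCompact_Icc.prod isCompact_Icc
  obtain ⟨K, hK⟩ := contDiff_coe_spherical.contDiffOn.exists_lipschitzOnWith one_ne_zero
    ((convex_Icc _ _).prod (convex_Icc _ _)) hcompact
  refine hausdorffMeasure_univ_lt_top_of_lipschitzOnWith (f := spherical) zero_le_two hK ?_
    image_spherical
  rw [hausdorffMeasure_prod_real]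
  exact hcompact.measure_lt_top

theorem hausdorffMeasure_S2_pos : 0 < (Measure.hausdorffMeasure 2 : Measure S2) Set.univ := by
  have hf : LipschitzWith 1 fun p : S2 => ((p : E3) 1, (p : E3) 2) := by
    refine LipschitzWith.of_dist_le_mul fun x y => ?_
    rw [NNReal.coe_one, one_mul, Prod.dist_eq, Subtype.dist_eq]
    exact max_le (PiLp.dist_apply_le _ _ 1) (PiLp.dist_apply_le _ _ 2)
  refine hausdorffMeasure_univ_pos_of_lipschitzWith
    (t := Set.Icc (-(1 / 4)) (1 / 4) ×ˢ Set.Icc (-(1 / 4)) (1 / 4)) zero_le_two hf ?_ ?_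
  · rw [hausdorffMeasure_prod_real, Measure.volume_eq_prod, Measure.prod_prod]
    simp
  · rintro ⟨a, b⟩ ⟨⟨ha, ha'⟩, hb, hb'⟩
    have hab : 0 ≤ 1 / 4 - a ^ 2 - b ^ 2 := by nlinarith
    refine ⟨⟨!₂[√(1 / 4 - a ^ 2 - b ^ 2), a, b], mem_S2_of_sq_add_sq_add_sq ?_⟩, by simp⟩
    rw [Real.sq_sqrt hab]
    ring

instance : IsProbabilityMeasure area :=
  ProbabilityTheory.cond_isProbabilityMeasure_of_finite hausdorffMeasure_S2_pos.ne'
    hausdorffMeasure_S2_lt_top.ne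

instance : SMulInvariantMeasure SO3 S2 area where
  measure_preimage_smul g B hB := by
    have hg : Measurable ((g • ·) : S2 → S2) := measurable_const_smul g
    rw [← Measure.map_apply hg hB, area, map_cond_univ hg]
    congr 2
    exact (IsometryEquiv.constSMul g).map_hausdorffMeasure 2

theorem area_eq_map_framePoint : area = haarSO3.map framePoint :=
  eq_map_smul_of_smulInvariant haarSO3 area pole

/-! ### Liouville measure as the image of Haar measure -/

theorem coe_pole : (pole : E3) = (1 / 2 : ℝ) • e0 := rfl

theorem inner_pole (x : E3) : inner ℝ (pole : E3) x = x 0 / 2 := by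
  simp [coe_pole, inner_E3, e0, div_eq_inv_mul]

theorem norm_sq_tangentCircle_pole (v : TangentCircle pole) :
    (v : E3) 1 ^ 2 + (v : E3) 2 ^ 2 = 1 := by
  have hnorm := norm_sq_E3 v
  have hinner := v.2.2
  rw [inner_pole] at hinner
  rw [v.2.1, (div_eq_zero_iff.1 hinner).resolve_right two_ne_zero] at hnorm
  linarith

/-- The unit circle of the tangent plane at the pole. -/
def poleCircle (t : ℝ) : TangentCircle pole :=
  ⟨!₂[0, Real.cos t, Real.sin t], by simp [EuclideanSpace.norm_eq, Fin.sum_univ_three],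
    by simp [inner_pole]⟩

theorem contDiff_coe_poleCircle : ContDiff ℝ 1 fun t => (poleCircle t : E3) := by
  rw [contDiff_euclidean]
  intro i
  fin_cases i <;> simp only [poleCircle, Matrix.cons_val, Fin.zero_eta, Fin.mk_one,
    Fin.reduceFinMk] <;> fun_prop

theorem image_poleCircle : poleCircle '' Set.Icc (-Real.pi) Real.pi = Set.univ := by
  refine Set.eq_univ_of_forall fun v => ?_
  have h0 : (v : E3) 0 = 0 := by
    have hinner := v.2.2
    rw [inner_pole] at hinner
    linarith
  obtain ⟨t, ht, hcos, hsin⟩ := exists_cos_sin (norm_sq_tangentCircle_pole v)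
  refine ⟨t, ht, Subtype.ext ?_⟩
  ext i
  fin_cases i <;> simp [poleCircle, h0, hcos, hsin]

theorem hausdorffMeasure_poleCircle_lt_top :
    (Measure.hausdorffMeasure 1 : Measure (TangentCircle pole)) Set.univ < ∞ := by
  obtain ⟨K, hK⟩ := contDiff_coe_poleCircle.contDiffOn.exists_lipschitzOnWith one_ne_zero
    (convex_Icc (-Real.pi) Real.pi) isCompact_Icc
  refine hausdorffMeasure_univ_lt_top_of_lipschitzOnWith (f := poleCircle) zero_le_one hK ?_
    image_poleCircle
  rw [hausdorffMeasure_real]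
  exact isCompact_Icc.measure_lt_top

theorem hausdorffMeasure_poleCircle_pos :
    0 < (Measure.hausdorffMeasure 1 : Measure (TangentCircle pole)) Set.univ := by
  have hf : LipschitzWith 1 fun v : TangentCircle pole => (v : E3) 1 := by
    refine LipschitzWith.of_dist_le_mul fun x y => ?_
    rw [NNReal.coe_one, one_mul, Subtype.dist_eq]
    exact PiLp.dist_apply_le _ _ 1
  refine hausdorffMeasure_univ_pos_of_lipschitzWith (t := Set.Icc (-1) 1) zero_le_one hf ?_ ?_
  · simp [hausdorffMeasure_real]
  · exact fun a ha => ⟨poleCircle (Real.arccos a), Real.cos_arccos ha.1 ha.2⟩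

theorem continuous_tangentLine (p : S2) : Continuous (tangentLine p) :=
  continuous_mk.comp ((continuous_const.prodMk continuous_subtype_val).subtype_mk _)

instance : IsProbabilityMeasure (fiberMeasure pole) :=
  have : IsProbabilityMeasure (ProbabilityTheory.cond
      (Measure.hausdorffMeasure 1 : Measure (TangentCircle pole)) Set.univ) :=
    ProbabilityTheory.cond_isProbabilityMeasure_of_finite hausdorffMeasure_poleCircle_pos.ne'
      hausdorffMeasure_poleCircle_lt_top.ne
  Measure.isProbabilityMeasure_map (continuous_tangentLine pole).measurable.aemeasurable

/-- A rotation as an isometry between tangent circles. -/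
def rotateCircle (g : SO3) (p : S2) : TangentCircle p ≃ᵢ TangentCircle (g • p) where
  toFun v := ⟨rotate g v, by rw [norm_rotate, v.2.1], by rw [coe_smul, inner_rotate, v.2.2]⟩
  invFun v := ⟨rotate g⁻¹ v, by rw [norm_rotate, v.2.1], by
    rw [← (rotateLinear g).symm_apply_apply p]
    exact (inner_rotate g⁻¹ (g • p : S2) v).trans v.2.2⟩
  left_inv v := Subtype.ext ((rotateLinear g).symm_apply_apply v)
  right_inv v := Subtype.ext ((rotateLinear g).apply_symm_apply v)
  isometry_toFun := Isometry.of_dist_eq fun v w => (rotateLinear g).dist_map v w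

theorem fiberMeasure_smul (g : SO3) (p : S2) :
    fiberMeasure (g • p) = (fiberMeasure p).map (g • ·) := by
  have hrotate : Measurable (rotateCircle g p) := (rotateCircle g p).continuous.measurable
  have hcomm : (g • ·) ∘ tangentLine p = tangentLine (g • p) ∘ rotateCircle g p := rfl
  rw [fiberMeasure, fiberMeasure,
    Measure.map_map (measurable_const_smul g) (continuous_tangentLine p).measurable, hcomm,
    ← Measure.map_map (continuous_tangentLine (g • p)).measurable hrotate,
    map_cond_univ hrotate, (rotateCircle g p).map_hausdorffMeasure]

theorem measurable_fiberMeasure : Measurable fiberMeasure := by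
  refine Measure.measurable_of_measurable_coe _ fun B hB => ?_
  have hfiber : (fun p => fiberMeasure p B) = fun p => fiberMeasure pole
      (Prod.mk (frame (horizontalVector p)) ⁻¹' ((fun a : SO3 × PS2 => a.1 • a.2) ⁻¹' B)) := by
    funext p
    have hp : frame (horizontalVector p) • pole = p := Subtype.ext (framePoint_frame _)
    conv_lhs => rw [← hp, fiberMeasure_smul, Measure.map_apply (measurable_const_smul _) hB]
    rfl
  rw [hfiber]
  exact (measurable_measure_prodMk_left (measurable_smul_prod hB)).comp
    (continuous_frame.measurable.comp measurable_horizontalVector)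

theorem liouville_eq_map_frameLine : liouville = haarSO3.map frameLine := by
  rw [show haarSO3.map frameLine = _ from
    (map_smul_prod haarSO3 (fiberMeasure pole) (PS2.mk poleVector)).symm]
  ext B hB
  have hm : Measurable fun p => fiberMeasure p B :=
    (Measure.measurable_coe hB).comp measurable_fiberMeasure
  rw [liouville, Measure.bind_apply hB measurable_fiberMeasure.aemeasurable,
    area_eq_map_framePoint, lintegral_map hm continuous_framePoint.measurable,
    Measure.map_apply measurable_smul_prod hB, Measure.prod_apply (measurable_smul_prod hB)]
  refine lintegral_congr fun g => ?_
  rw [framePoint, fiberMeasure_smul, Measure.map_apply (measurable_const_smul g) hB]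
  rfl

instance : IsProbabilityMeasure liouville := by
  rw [liouville_eq_map_frameLine]
  exact Measure.isProbabilityMeasure_map continuous_frameLine.measurable.aemeasurable

/-! ### The twist map preserves area -/

/-- The rotation by the angle `t` about the first axis. -/
def axisRotation (t : ℝ) : SO3 :=
  ⟨!![1, 0, 0; 0, Real.cos t, -Real.sin t; 0, Real.sin t, Real.cos t], by
    have h := Real.sin_sq_add_cos_sq t
    rw [Matrix.mem_specialOrthogonalGroup_iff, Matrix.mem_orthogonalGroup_iff']
    constructor
    · ext i j
      fin_cases i <;> fin_cases j <;> simp [Matrix.mul_apply, Fin.sum_univ_three] <;> linarith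
    · rw [Matrix.det_fin_three]
      simp
      linarith⟩

theorem mat_axisRotation (t : ℝ) : mat (axisRotation t) =
    !![1, 0, 0; 0, Real.cos t, -Real.sin t; 0, Real.sin t, Real.cos t] := rfl

theorem continuous_axisRotation : Continuous axisRotation := by
  refine Continuous.subtype_mk (continuous_matrix fun i j => ?_) _
  fin_cases i <;> fin_cases j <;> simp only [Matrix.of_apply, Matrix.cons_val, Matrix.cons_val',
    Fin.zero_eta, Fin.mk_one, Fin.reduceFinMk] <;> fun_prop

theorem twist_eq_rotate (ε : ℝ) (x : E3) :
    twist ε x = rotate (axisRotation (2 * Real.pi * (x 0 + 1 / 2) * ε)) x := by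
  ext i
  rw [rotate_apply, mat_axisRotation]
  fin_cases i <;> simp [twist]
  ring

theorem axisRotation_smul_pole (t : ℝ) : axisRotation t • pole = pole := by
  refine Subtype.ext ?_
  ext i
  rw [coe_smul, rotate_apply, mat_axisRotation, coe_pole]
  fin_cases i <;> simp [e0]

theorem smul_apply_zero_of_smul_pole {g : SO3} (hg : g • pole = pole) (p : S2) :
    (g • p : S2).1 0 = p.1 0 := by
  have h := inner_rotate g pole p
  rw [← coe_smul, hg, inner_pole, inner_pole] at h
  change rotate g p 0 = p.1 0
  linarith

/-- The twist map of the sphere. -/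
def twistS2 (ε : ℝ) (p : S2) : S2 :=
  ⟨twist ε p, by rw [mem_sphere_zero_iff_norm, norm_twist, norm_eq_of_mem_sphere]⟩

theorem continuous_twistS2 (ε : ℝ) : Continuous (twistS2 ε) :=
  Continuous.subtype_mk ((contDiff_twist ε).continuous.comp continuous_subtype_val) _

/-- On each circle of latitude the twist is a rotation about the axis, and the group of these
rotations preserves area. -/
theorem map_twistS2_area (ε : ℝ) : area.map (twistS2 ε) = area := by
  let H := MulAction.stabilizer SO3 pole
  have hclosed : IsClosed (H : Set SO3) :=
    isClosed_eq (continuous_id.smul continuous_const) continuous_const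
  have : CompactSpace H := isCompact_iff_compactSpace.1 hclosed.isCompact
  let μ : Measure H := Measure.haarMeasure ⊤
  have : IsProbabilityMeasure μ :=
    ⟨by rw [← TopologicalSpace.PositiveCompacts.coe_top, Measure.haarMeasure_self]⟩
  let τ (p : S2) : H := ⟨axisRotation (2 * Real.pi * ((p : E3) 0 + 1 / 2) * ε),
    axisRotation_smul_pole _⟩
  have hτ : Measurable τ := by
    refine (Continuous.subtype_mk (continuous_axisRotation.comp ?_) _).measurable
    fun_prop
  have htwist : twistS2 ε = fun p => τ p • p := funext fun p => Subtype.ext (twist_eq_rotate ε p)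
  rw [htwist]
  refine map_smul_self_of_smulInvariant μ area hτ fun g p => Subtype.ext ?_
  have h0 : ((g • p : S2) : E3) 0 = (p : E3) 0 := smul_apply_zero_of_smul_pole g.2 p
  simp only [τ, h0]

/-! ### The first row of a random rotation -/

/-- The first row of a rotation, as a point of the unit sphere. -/
def firstRow (g : SO3) : E3 := rotate g⁻¹ e0

theorem firstRow_apply (g : SO3) (i : Fin 3) : firstRow g i = mat g 0 i := by
  simp [firstRow, rotate_apply, e0, mat_inv]

theorem norm_firstRow (g : SO3) : ‖firstRow g‖ = 1 := by
  rw [firstRow, norm_rotate, e0, EuclideanSpace.norm_eq]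
  simp [Fin.sum_univ_three]

theorem measurable_firstRow : Measurable firstRow :=
  (continuous_rotate.comp (continuous_inv.prodMk continuous_const)).measurable

theorem lintegral_smul_firstRow (Θ : E3 → ℝ≥0∞) (x : E3) :
    ∫⁻ g, Θ (‖x‖ • firstRow g) ∂haarSO3 = ∫⁻ g, Θ (rotate g⁻¹ x) ∂haarSO3 := by
  obtain ⟨c, hc⟩ := exists_rotate_e0 x
  rw [← lintegral_mul_left_eq_self _ c⁻¹]
  refine lintegral_congr fun g => congrArg Θ ?_
  conv_rhs => rw [hc]
  rw [rotate_smul, ← rotate_mul, firstRow, mul_inv_rev, inv_inv]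

/-- Polar coordinates: a uniform point of a ball has the direction of the first row of a
uniform rotation, independent of its length. -/
theorem lintegral_ball_firstRow {Θ : E3 → ℝ≥0∞} (hΘ : Measurable Θ) (r : ℝ) :
    ∫⁻ x in Metric.ball (0 : E3) r, ∫⁻ g, Θ (‖x‖ • firstRow g) ∂haarSO3 =
      ∫⁻ x in Metric.ball (0 : E3) r, Θ x := by
  have hm : Measurable fun a : E3 × SO3 => Θ (rotate a.2⁻¹ a.1) :=
    hΘ.comp (continuous_rotate.comp ((continuous_inv.comp continuous_snd).prodMk
      continuous_fst)).measurable
  have hinv (g : SO3) :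
      ∫⁻ x in Metric.ball (0 : E3) r, Θ (rotate g⁻¹ x) = ∫⁻ x in Metric.ball (0 : E3) r, Θ x := by
    have h := (rotateLinear g⁻¹).measurePreserving.setLIntegral_comp_preimage
      (s := Metric.ball 0 r) measurableSet_ball hΘ
    rwa [LinearIsometryEquiv.preimage_ball, map_zero] at h
  simp_rw [lintegral_smul_firstRow]
  rw [lintegral_lintegral_swap hm.aemeasurable]
  simp [hinv]

/-- The function `|x₁ x₂| ^ (-1/2)`, with value `∞` where the product vanishes. It controls the
concentration of the trace along the cosets of the rotations about the first axis. -/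
def weight (x : E3) : ℝ≥0∞ := ENNReal.ofReal |x 1 * x 2| ^ (-(1 / 2) : ℝ)

theorem measurable_weight : Measurable weight := by
  unfold weight
  fun_prop

theorem integrableOn_ball_abs_rpow {r : ℝ} (hr : -1 < r) (R : ℝ) :
    IntegrableOn (fun x : ℝ => |x| ^ r) (Metric.ball 0 R) := by
  refine integrableOn_ball_of_norm_le_rpow (C := 1) (α := -r) (by simp) (by simp; linarith)
    (ae_of_all _ fun x => ?_) (continuous_abs.measurable.pow_const r).aestronglyMeasurable
  rw [Real.norm_of_nonneg (by positivity), neg_neg, one_mul, Real.norm_eq_abs]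

theorem ae_apply_ne_zero (i : Fin 3) : ∀ᵐ x : E3, x i ≠ 0 := by
  refine (PiLp.volume_preserving_ofLp (Fin 3)).quasiMeasurePreserving.ae
    (p := fun x : Fin 3 → ℝ => x i ≠ 0) ?_
  rw [ae_iff]
  simpa [volume_pi] using Measure.pi_hyperplane (fun _ : Fin 3 => (volume : Measure ℝ)) i 0

theorem lintegral_ball_weight_lt_top : ∫⁻ x in Metric.ball (0 : E3) 1, weight x < ∞ := by
  let r : Fin 3 → ℝ := ![0, -(1 / 2), -(1 / 2)]
  have hr (i : Fin 3) : -1 < r i := by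
    fin_cases i <;> norm_num [r]
  have hint : Integrable fun x : E3 =>
      ∏ i, (Metric.ball (0 : ℝ) 1).indicator (fun t => |t| ^ r i) (x i) :=
    (PiLp.volume_preserving_ofLp (Fin 3)).integrable_comp_of_integrable (.fintype_prod fun i =>
      (integrableOn_ball_abs_rpow (hr i) 1).integrable_indicator measurableSet_ball)
  refine lt_of_le_of_lt ?_ hint.2
  rw [← lintegral_indicator measurableSet_ball]
  refine lintegral_mono_ae ?_
  filter_upwards [ae_apply_ne_zero 1, ae_apply_ne_zero 2] with x h1 h2
  refine Set.indicator_apply_le' (fun hx => le_of_eq ?_) fun _ => zero_le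
  have hmem (i : Fin 3) : x i ∈ Metric.ball (0 : ℝ) 1 :=
    mem_ball_zero_iff.2 ((PiLp.norm_apply_le x i).trans_lt (mem_ball_zero_iff.1 hx))
  have hprod : ∏ i, (Metric.ball (0 : ℝ) 1).indicator (fun t => |t| ^ r i) (x i) =
      |x 1 * x 2| ^ (-(1 / 2) : ℝ) := by
    simp only [Set.indicator_of_mem (hmem _)]
    rw [Fin.prod_univ_three, abs_mul, Real.mul_rpow (abs_nonneg _) (abs_nonneg _)]
    simp [r]
  rw [hprod, Real.enorm_of_nonneg (by positivity), weight,
    ENNReal.ofReal_rpow_of_pos (abs_pos.2 (mul_ne_zero h1 h2))]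

theorem weight_le_weight_smul {r : ℝ} (hr : |r| ≤ 1) (x : E3) : weight x ≤ weight (r • x) := by
  rw [weight, weight, ENNReal.rpow_neg, ENNReal.rpow_neg]
  refine ENNReal.inv_le_inv.2 (ENNReal.rpow_le_rpow (ENNReal.ofReal_le_ofReal ?_) (by norm_num))
  have hsmul : |(r • x) 1 * (r • x) 2| = |r| * |r| * |x 1 * x 2| := by
    simp only [PiLp.smul_apply, smul_eq_mul, abs_mul]
    ring
  rw [hsmul]
  exact mul_le_of_le_one_left (abs_nonneg _) (mul_le_one₀ hr (abs_nonneg _) hr)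

theorem lintegral_weight_firstRow_lt_top : ∫⁻ g, weight (firstRow g) ∂haarSO3 < ∞ := by
  have hle : (∫⁻ g, weight (firstRow g) ∂haarSO3) * volume (Metric.ball (0 : E3) 1) ≤
      ∫⁻ x in Metric.ball (0 : E3) 1, weight x := by
    rw [← lintegral_ball_firstRow measurable_weight, ← setLIntegral_const]
    refine setLIntegral_mono' measurableSet_ball fun x hx => lintegral_mono fun g => ?_
    refine weight_le_weight_smul ?_ _
    rw [abs_norm]
    exact (mem_ball_zero_iff.1 hx).le
  by_contra htop
  rw [not_lt_top_iff.1 htop, ENNReal.top_mul (Metric.measure_ball_pos _ _ one_pos).ne'] at hle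
  exact (hle.trans_lt lintegral_ball_weight_lt_top).false

/-- The cone spanned by the possible first rows of the rotations whose first entry is at least
`1 - s`. -/
def polarCone (s : ℝ) : Set E3 := {x | (1 - s) * ‖x‖ ≤ x 0 ∧ 0 < x 0}

theorem measurableSet_polarCone (s : ℝ) : MeasurableSet (polarCone s) :=
  (measurableSet_le (f := fun x : E3 => (1 - s) * ‖x‖) (g := fun x => x 0) (by fun_prop)
    (by fun_prop)).inter (measurableSet_lt (f := fun _ : E3 => (0 : ℝ)) (by fun_prop) (by fun_prop))

theorem le_entry_of_smul_firstRow_mem_polarCone {s r : ℝ} {g : SO3} (hr : 0 ≤ r)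
    (h : r • firstRow g ∈ polarCone s) : 1 - s ≤ mat g 0 0 := by
  obtain ⟨hle, hpos⟩ := h
  rw [norm_smul, Real.norm_of_nonneg hr, norm_firstRow, mul_one] at hle
  rw [PiLp.smul_apply, smul_eq_mul, firstRow_apply] at hle hpos
  exact le_of_mul_le_mul_left (by linarith) (hr.lt_of_ne' fun h => by simp [h] at hpos)

/-- The box `[1/2, 3/4] × [-√s/4, √s/4]²` lies in the cone. -/
theorem le_volume_polarCone_inter_ball {s : ℝ} (hs : 0 < s) (hs1 : s ≤ 1) :
    ENNReal.ofReal (s / 16) ≤ volume (polarCone s ∩ Metric.ball 0 1) := by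
  let lower : Fin 3 → ℝ := ![1 / 2, -(√s / 4), -(√s / 4)]
  let upper : Fin 3 → ℝ := ![3 / 4, √s / 4, √s / 4]
  have hvol : volume (WithLp.ofLp ⁻¹' Set.Icc lower upper : Set E3) = ENNReal.ofReal (s / 16) := by
    rw [(PiLp.volume_preserving_ofLp (Fin 3)).measure_preimage measurableSet_Icc.nullMeasurableSet,
      Real.volume_Icc_pi, ← ENNReal.ofReal_prod_of_nonneg, Fin.prod_univ_three]
    · congr 1
      simp only [lower, upper, Matrix.cons_val]
      linear_combination (1 / 16 : ℝ) * Real.mul_self_sqrt hs.le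
    · intro i _
      fin_cases i <;> norm_num [lower, upper] <;> positivity
  rw [← hvol]
  refine measure_mono fun x ⟨hl, hu⟩ => ?_
  have h0 : 1 / 2 ≤ x 0 := hl 0
  have h0' : x 0 ≤ 3 / 4 := hu 0
  have h0sq : 1 / 4 ≤ x 0 ^ 2 := by nlinarith
  have hsq {t : ℝ} (h : -(√s / 4) ≤ t) (h' : t ≤ √s / 4) : t ^ 2 ≤ s / 16 := by
    nlinarith [Real.sq_sqrt hs.le]
  have h1 : x 1 ^ 2 ≤ s / 16 := hsq (hl 1) (hu 1)
  have h2 : x 2 ^ 2 ≤ s / 16 := hsq (hl 2) (hu 2)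
  have hn := norm_sq_E3 x
  refine ⟨⟨abs_le_of_sq_le_sq' ?_ (by linarith) |>.2, by linarith⟩, ?_⟩
  · calc ((1 - s) * ‖x‖) ^ 2 = (1 - s) ^ 2 * ‖x‖ ^ 2 := by ring
      _ ≤ (1 - s) * ‖x‖ ^ 2 := mul_le_mul_of_nonneg_right (by nlinarith) (by positivity)
      _ ≤ (1 - s) * (x 0 ^ 2 + s / 8) := mul_le_mul_of_nonneg_left (by linarith) (by linarith)
      _ ≤ x 0 ^ 2 := by nlinarith
  · rw [mem_ball_zero_iff]
    exact abs_lt_of_sq_lt_sq' (by nlinarith) zero_le_one |>.2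

theorem volume_polarCone_inter_ball_le (s : ℝ) :
    volume (polarCone s ∩ Metric.ball 0 1) ≤
      haarSO3 {g | 1 - s ≤ mat g 0 0} * volume (Metric.ball (0 : E3) 1) := by
  have hset : MeasurableSet {g : SO3 | 1 - s ≤ mat g 0 0} :=
    measurableSet_le measurable_const (continuous_entry 0 0).measurable
  rw [← Measure.restrict_apply (measurableSet_polarCone s),
    ← lintegral_indicator_one (measurableSet_polarCone s),
    ← lintegral_ball_firstRow (measurable_one.indicator (measurableSet_polarCone s)),
    ← setLIntegral_const, ← lintegral_indicator_one hset]
  refine lintegral_mono fun x => lintegral_mono fun g => ?_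
  refine Set.indicator_apply_le' (fun h => ?_) fun _ => zero_le
  rw [Set.indicator_of_mem (a := g) (le_entry_of_smul_firstRow_mem_polarCone (norm_nonneg x) h)]
  rfl

theorem exists_le_haarSO3_one_sub_le_entry : ∃ c : ℝ, 0 < c ∧ ∀ s : ℝ, 0 < s → s ≤ 1 →
    ENNReal.ofReal (c * s) ≤ haarSO3 {g | 1 - s ≤ mat g 0 0} := by
  have hV : 0 < volume.real (Metric.ball (0 : E3) 1) :=
    ENNReal.toReal_pos (Metric.measure_ball_pos _ _ one_pos).ne' measure_ball_lt_top.ne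
  refine ⟨(16 * volume.real (Metric.ball (0 : E3) 1))⁻¹, by positivity, fun s hs hs1 => ?_⟩
  have h := (le_volume_polarCone_inter_ball hs hs1).trans (volume_polarCone_inter_ball_le s)
  rw [← ofReal_measureReal (s := Metric.ball (0 : E3) 1), ← ENNReal.div_le_iff
    (ENNReal.ofReal_pos.2 hV).ne' ENNReal.ofReal_ne_top, ← ENNReal.ofReal_div_of_pos hV] at h
  refine le_of_eq_of_le (congrArg _ ?_) h
  field_simp

/-! ### The trace of a random rotation -/

theorem measure_mul_measure_univ {G α : Type*} [Group G] [MeasurableSpace G] [MeasurableMul₂ G]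
    [MeasurableSpace α] (μ : Measure G) [SFinite μ] [μ.IsMulRightInvariant] (ν : Measure α)
    [SFinite ν] {γ : α → G} (hγ : Measurable γ) {S : Set G} (hS : MeasurableSet S) :
    μ S * ν Set.univ = ∫⁻ g, ν {s | g * γ s ∈ S} ∂μ := by
  have hm : MeasurableSet {a : G × α | a.1 * γ a.2 ∈ S} :=
    (measurable_fst.mul (hγ.comp measurable_snd)) hS
  have hsection (s : α) : μ ((fun g => (g, s)) ⁻¹' {a : G × α | a.1 * γ a.2 ∈ S}) = μ S :=
    measure_preimage_mul_right μ (γ s) S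
  have hswap := Measure.prod_apply_symm (μ := μ) (ν := ν) hm
  simp only [hsection, lintegral_const] at hswap
  rw [← hswap, Measure.prod_apply hm]
  rfl

theorem volume_inter_Ioc_eq_of_periodic {S : Set ℝ} (hS : MeasurableSet S) {T : ℝ} (hT : 0 < T)
    (hper : Function.Periodic (· ∈ S) T) (a b : ℝ) :
    volume (S ∩ Set.Ioc a (a + T)) = volume (S ∩ Set.Ioc b (b + T)) := by
  refine (isAddFundamentalDomain_Ioc hT a).measure_set_eq (isAddFundamentalDomain_Ioc hT b) hS
    fun g => Set.ext fun x => ?_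
  obtain ⟨n, hn⟩ := g.2
  simpa [AddSubgroup.vadd_def, ← hn, add_comm] using iff_of_eq (hper.int_mul n x)

theorem continuous_trace : Continuous fun g : SO3 => (mat g).trace :=
  continuous_mat.matrix_trace

theorem one_add_entry_nonneg (g : SO3) : 0 ≤ 1 + mat g 0 0 := by
  linarith [(abs_le.1 (abs_entry_le_one g 0 0)).1]

theorem exists_trace_mul_axisRotation (g : SO3) : ∃ t, ∀ s,
    (mat (g * axisRotation s)).trace + 1 = (1 + mat g 0 0) * (1 + Real.cos (s - t)) := by
  obtain ⟨t, -, h1, h2⟩ := exists_polar (mat g 1 1 + mat g 2 2) (mat g 1 2 - mat g 2 1)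
  have hA : √((mat g 1 1 + mat g 2 2) ^ 2 + (mat g 1 2 - mat g 2 1) ^ 2) = 1 + mat g 0 0 := by
    rw [Real.sqrt_eq_iff_mul_self_eq (by positivity) (one_add_entry_nonneg g)]
    have r1 := row_inner g 1 1
    have r2 := row_inner g 2 2
    have c0 := col_inner g 0 0
    simp only [if_true] at r1 r2 c0
    linear_combination r1 + r2 - c0 - 2 * entry_zero_zero g
  rw [hA] at h1 h2
  refine ⟨t, fun s => ?_⟩
  have htrace : (mat (g * axisRotation s)).trace =
      mat g 0 0 + (mat g 1 1 + mat g 2 2) * Real.cos s + (mat g 1 2 - mat g 2 1) * Real.sin s := by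
    rw [mat_mul, mat_axisRotation, Matrix.trace_fin_three]
    simp [Matrix.mul_apply, Fin.sum_univ_three]
    ring
  rw [htrace, Real.cos_sub]
  linear_combination Real.cos s * h1 + Real.sin s * h2

theorem trace_add_one_nonneg (g : SO3) : 0 ≤ (mat g).trace + 1 := by
  obtain ⟨t, ht⟩ := exists_trace_mul_axisRotation (g * (axisRotation 0)⁻¹)
  specialize ht 0
  rw [inv_mul_cancel_right] at ht
  rw [ht]
  exact mul_nonneg (one_add_entry_nonneg _) (by linarith [Real.neg_one_le_cos (0 - t)])

/-- Fubini along the cosets of the group of rotations about the first axis. -/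
theorem haarSO3_trace_add_one_mem {Q : Set ℝ} (hQ : MeasurableSet Q) :
    haarSO3 {u | (mat u).trace + 1 ∈ Q} * ENNReal.ofReal (2 * Real.pi) =
      ∫⁻ g, volume ({s | (1 + mat g 0 0) * (1 + Real.cos s) ∈ Q} ∩
        Set.Ioc (-Real.pi) Real.pi) ∂haarSO3 := by
  have hS : MeasurableSet {u : SO3 | (mat u).trace + 1 ∈ Q} :=
    (continuous_trace.add continuous_const).measurable hQ
  have h := measure_mul_measure_univ haarSO3 (volume.restrict (Set.Ioc (-Real.pi) Real.pi))
    continuous_axisRotation.measurable hS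
  rw [Measure.restrict_apply_univ, Real.volume_Ioc, sub_neg_eq_add, ← two_mul] at h
  rw [h]
  refine lintegral_congr fun g => ?_
  obtain ⟨t, ht⟩ := exists_trace_mul_axisRotation g
  let A : Set ℝ := {s | (1 + mat g 0 0) * (1 + Real.cos s) ∈ Q}
  have hA : MeasurableSet A := Continuous.measurable (by fun_prop) hQ
  have hper : Function.Periodic (· ∈ A) (2 * Real.pi) := fun s => by
    simp only [A, Set.mem_ofPred_eq, Real.cos_add_two_pi]
  have hset : {s | g * axisRotation s ∈ {u : SO3 | (mat u).trace + 1 ∈ Q}} ∩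
      Set.Ioc (-Real.pi) Real.pi =
      (· - t) ⁻¹' (A ∩ Set.Ioc (-Real.pi - t) (-Real.pi - t + 2 * Real.pi)) := by
    ext s
    simp only [A, Set.mem_inter_iff, Set.mem_preimage, Set.mem_ofPred_eq, ht, Set.mem_Ioc,
      sub_lt_sub_iff_right]
    refine and_congr_right fun _ => and_congr_right fun _ => ?_
    constructor <;> intro h <;> linarith
  rw [Measure.restrict_apply' measurableSet_Ioc, hset]
  simp only [sub_eq_add_neg]
  rw [measure_preimage_add_right,
    volume_inter_Ioc_eq_of_periodic hA Real.two_pi_pos hper _ (-Real.pi)]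
  congr 3
  ring

theorem mul_sq_sub_le_abs_cos_sub_cos {x y : ℝ} (hx : x ∈ Set.Icc 0 Real.pi)
    (hy : y ∈ Set.Icc 0 Real.pi) : 2 / Real.pi ^ 2 * (x - y) ^ 2 ≤ |Real.cos x - Real.cos y| := by
  have hsin : Real.sin ((x - y) / 2) ^ 2 ≤ Real.sin ((x + y) / 2) ^ 2 := by
    have h : Real.sin ((x + y) / 2) ^ 2 - Real.sin ((x - y) / 2) ^ 2 = Real.sin x * Real.sin y := by
      rw [Real.sin_sq_eq_half_sub, Real.sin_sq_eq_half_sub, mul_div_cancel₀ _ two_ne_zero,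
        mul_div_cancel₀ _ two_ne_zero, Real.cos_add, Real.cos_sub]
      ring
    linarith [mul_nonneg (Real.sin_nonneg_of_mem_Icc hx) (Real.sin_nonneg_of_mem_Icc hy)]
  have hxy : |x - y| ≤ Real.pi :=
    abs_le.2 ⟨by linarith [hx.1, hy.2], by linarith [hx.2, hy.1]⟩
  have hjordan := Real.mul_abs_le_abs_sin (x := (x - y) / 2) (by
    rw [abs_div, abs_two]
    linarith)
  calc 2 / Real.pi ^ 2 * (x - y) ^ 2 = 2 * (2 / Real.pi * |(x - y) / 2|) ^ 2 := by
        rw [mul_pow, sq_abs]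
        ring
    _ ≤ 2 * |Real.sin ((x - y) / 2)| ^ 2 := by gcongr
    _ ≤ 2 * (|Real.sin ((x + y) / 2)| * |Real.sin ((x - y) / 2)|) := by
        rw [sq]
        exact mul_le_mul_of_nonneg_left
          (mul_le_mul_of_nonneg_right (sq_le_sq.1 hsin) (abs_nonneg _)) zero_le_two
    _ = |Real.cos x - Real.cos y| := by
        rw [Real.cos_sub_cos, abs_mul, abs_mul, abs_neg, abs_two]
        ring

theorem volume_Icc_abs_cos_sub_le {d η : ℝ} (hη : 0 ≤ η) :
    volume {x ∈ Set.Icc 0 Real.pi | |Real.cos x - d| ≤ η} ≤ ENNReal.ofReal (Real.pi * √η) := by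
  refine (Real.volume_le_diam _).trans
    (Metric.ediam_le_of_forall_dist_le fun x ⟨hx, hxd⟩ y ⟨hy, hyd⟩ => ?_)
  have hcos : |Real.cos x - Real.cos y| ≤ 2 * η := by
    have := abs_sub_le (Real.cos x) d (Real.cos y)
    rw [abs_sub_comm d] at this
    linarith
  have hsq := (mul_sq_sub_le_abs_cos_sub_cos hx hy).trans hcos
  rw [div_mul_eq_mul_div, div_le_iff₀ (by positivity)] at hsq
  refine abs_le_of_sq_le_sq ?_ (by positivity)
  rw [mul_pow, Real.sq_sqrt hη]
  linarith

theorem volume_Ioc_abs_cos_sub_le {d η : ℝ} (hη : 0 ≤ η) :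
    volume ({x | |Real.cos x - d| ≤ η} ∩ Set.Ioc (-Real.pi) Real.pi) ≤
      ENNReal.ofReal (2 * Real.pi * √η) := by
  let H : Set ℝ := {x ∈ Set.Icc 0 Real.pi | |Real.cos x - d| ≤ η}
  have hsub : {x | |Real.cos x - d| ≤ η} ∩ Set.Ioc (-Real.pi) Real.pi ⊆ H ∪ -H := by
    rintro x ⟨hx, hlo, hhi⟩
    rcases le_total 0 x with h | h
    · exact Or.inl ⟨⟨h, hhi⟩, hx⟩
    · exact Or.inr ⟨⟨by linarith, by linarith⟩, by rwa [Real.cos_neg]⟩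
  calc volume ({x | |Real.cos x - d| ≤ η} ∩ Set.Ioc (-Real.pi) Real.pi)
      ≤ volume H + volume (-H) := (measure_mono hsub).trans (measure_union_le _ _)
    _ ≤ ENNReal.ofReal (Real.pi * √η) + ENNReal.ofReal (Real.pi * √η) := by
        rw [Measure.measure_neg]
        exact add_le_add (volume_Icc_abs_cos_sub_le hη) (volume_Icc_abs_cos_sub_le hη)
    _ = ENNReal.ofReal (2 * Real.pi * √η) := by
        rw [← ENNReal.ofReal_add (by positivity) (by positivity), ← two_mul, mul_assoc]

theorem abs_mul_le_one_add_entry (g : SO3) : |mat g 0 1 * mat g 0 2| ≤ 1 + mat g 0 0 := by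
  have h := row_inner g 0 0
  simp only [if_true] at h
  have h0 := abs_le.1 (abs_entry_le_one g 0 0)
  rw [abs_le]
  constructor <;> nlinarith [sq_nonneg (mat g 0 1 - mat g 0 2), sq_nonneg (mat g 0 1 + mat g 0 2)]

theorem volume_coset_trace_band_le {g : SO3} (hg : weight (firstRow g) ≠ ∞) (c : ℝ) {t : ℝ}
    (ht : 0 ≤ t) :
    volume ({s | (1 + mat g 0 0) * (1 + Real.cos s) ∈ Set.Icc (c - t) (c + t)} ∩
      Set.Ioc (-Real.pi) Real.pi) ≤ ENNReal.ofReal (2 * Real.pi * √t) * weight (firstRow g) := by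
  rw [weight, firstRow_apply, firstRow_apply] at hg ⊢
  have hle := abs_mul_le_one_add_entry g
  have hw : 0 < |mat g 0 1 * mat g 0 2| := by
    refine (abs_nonneg _).lt_of_ne fun h => hg ?_
    rw [← h, ENNReal.ofReal_zero, ENNReal.zero_rpow_of_neg (by norm_num)]
  set w := |mat g 0 1 * mat g 0 2|
  set A := 1 + mat g 0 0
  have hA : 0 < A := hw.trans_le hle
  have hsub : {s | A * (1 + Real.cos s) ∈ Set.Icc (c - t) (c + t)} ⊆
      {s | |Real.cos s - (c / A - 1)| ≤ t / w} := by
    rintro s ⟨hlo, hhi⟩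
    have hcos : Real.cos s - (c / A - 1) = (A * (1 + Real.cos s) - c) / A := by
      field_simp
      ring
    rw [Set.mem_ofPred_eq, hcos, abs_div, abs_of_pos hA]
    exact div_le_div₀ ht (abs_le.2 ⟨by linarith, by linarith⟩) hw hle
  refine (measure_mono (Set.inter_subset_inter_left _ hsub)).trans
    ((volume_Ioc_abs_cos_sub_le (by positivity)).trans_eq ?_)
  rw [ENNReal.ofReal_rpow_of_pos hw, ← ENNReal.ofReal_mul (by positivity), Real.sqrt_div ht,
    Real.rpow_neg hw.le, ← Real.sqrt_eq_rpow, mul_div_assoc', div_eq_mul_inv]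

theorem exists_haarSO3_trace_band_le : ∃ C : ℝ, 0 < C ∧ ∀ c t : ℝ, 0 ≤ t →
    haarSO3 {u | (mat u).trace + 1 ∈ Set.Icc (c - t) (c + t)} ≤ ENNReal.ofReal (C * √t) := by
  set K := ∫⁻ g, weight (firstRow g) ∂haarSO3 with hK
  have hKt : K ≠ ∞ := lintegral_weight_firstRow_lt_top.ne
  have hmeas : Measurable fun g => weight (firstRow g) := measurable_weight.comp measurable_firstRow
  refine ⟨K.toReal + 1, by positivity, fun c t ht => ?_⟩
  have h : haarSO3 {u | (mat u).trace + 1 ∈ Set.Icc (c - t) (c + t)} *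
      ENNReal.ofReal (2 * Real.pi) ≤ ENNReal.ofReal (2 * Real.pi * √t) * K := by
    rw [haarSO3_trace_add_one_mem measurableSet_Icc, hK, ← lintegral_const_mul _ hmeas]
    refine lintegral_mono_ae ?_
    filter_upwards [ae_lt_top hmeas hKt] with g hg
    exact volume_coset_trace_band_le hg.ne c ht
  rw [← ENNReal.ofReal_toReal hKt, ← ENNReal.ofReal_mul (by positivity),
    ← ENNReal.le_div_iff_mul_le (Or.inl (ENNReal.ofReal_pos.2 Real.two_pi_pos).ne')
    (Or.inl ENNReal.ofReal_ne_top), ← ENNReal.ofReal_div_of_pos Real.two_pi_pos] at h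
  refine h.trans (ENNReal.ofReal_le_ofReal ?_)
  rw [mul_assoc, mul_div_cancel_left₀ _ Real.two_pi_pos.ne', mul_comm]
  gcongr
  linarith

/-! ### The balls of the rotation group -/

theorem rotationBall_eq_univ {δ : ℝ} (hδ : Real.pi < δ) : rotationBall δ = Set.univ :=
  Set.eq_univ_of_forall fun _ => (Real.arccos_le_pi _).trans_lt hδ

theorem mem_rotationBall_iff {δ : ℝ} (h0 : 0 < δ) (hδ : δ ≤ Real.pi) (g : SO3) :
    g ∈ rotationBall δ ↔ 2 + 2 * Real.cos δ < (mat g).trace + 1 := by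
  have htrace : ((mat g).trace - 1) / 2 ∈ Set.Icc (-1 : ℝ) 1 := by
    have hi i := (abs_le.1 (abs_entry_le_one g i i)).2
    refine ⟨by linarith [trace_add_one_nonneg g], ?_⟩
    rw [Matrix.trace_fin_three]
    linarith [hi 0, hi 1, hi 2]
  have hlt := Real.strictAntiOn_arccos.lt_iff_gt htrace (Real.cos_mem_Icc δ)
  rw [Real.arccos_cos h0.le hδ] at hlt
  refine hlt.trans ?_
  constructor <;> intro h <;> linarith

theorem measurableSet_rotationBall (δ : ℝ) : MeasurableSet (rotationBall δ) :=
  measurableSet_lt (Real.continuous_arccos.comp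
    ((continuous_trace.sub continuous_const).div_const _)).measurable measurable_const

theorem two_add_two_mul_cos_lt_mul {δ : ℝ} (h0 : 0 < δ) (hδ : δ ≤ Real.pi) {a s : ℝ}
    (ha : 2 - δ ^ 2 / 20 ≤ a) (hs : |s| ≤ δ / 4) : 2 + 2 * Real.cos δ < a * (1 + Real.cos s) := by
  have hpi : Real.pi ^ 2 < 10 := by nlinarith [Real.pi_lt_d2, Real.pi_pos]
  have hδ2 : δ ^ 2 ≤ Real.pi ^ 2 := pow_le_pow_left₀ h0.le hδ 2
  have hcos : Real.cos δ < 1 - δ ^ 2 / 10 := by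
    have hjordan := Real.cos_le_one_sub_mul_cos_sq (x := δ) (by rwa [abs_of_pos h0])
    have hconst : 1 / 10 * δ ^ 2 < 2 / Real.pi ^ 2 * δ ^ 2 := by
      refine mul_lt_mul_of_pos_right ?_ (by positivity)
      rw [div_lt_div_iff₀ (by norm_num) (by positivity)]
      linarith
    linarith
  have hs2 : 2 - δ ^ 2 / 20 ≤ 1 + Real.cos s := by
    have := sq_le_sq' (by linarith [(abs_le.1 hs).1]) (abs_le.1 hs).2
    linarith [Real.one_sub_sq_div_two_le_cos (x := s), sq_nonneg δ]
  nlinarith [mul_le_mul ha hs2 (by linarith) (by linarith), sq_nonneg (δ ^ 2)]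

theorem exists_le_haarSO3_rotationBall : ∃ c : ℝ, 0 < c ∧ ∀ δ : ℝ, 0 < δ → δ ≤ Real.pi →
    c * δ ^ 3 ≤ haarSO3.real (rotationBall δ) := by
  have hpi := Real.pi_pos
  obtain ⟨c, hc, hcap⟩ := exists_le_haarSO3_one_sub_le_entry
  refine ⟨c / (80 * Real.pi), by positivity, fun δ h0 hδ => ?_⟩
  have hsection (g : SO3) (hg : 1 - δ ^ 2 / 20 ≤ mat g 0 0) :
      ENNReal.ofReal (δ / 2) ≤ volume ({s | (1 + mat g 0 0) * (1 + Real.cos s) ∈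
        Set.Ioi (2 + 2 * Real.cos δ)} ∩ Set.Ioc (-Real.pi) Real.pi) := by
    have hIoc : ENNReal.ofReal (δ / 2) = volume (Set.Ioc (-(δ / 4)) (δ / 4)) := by
      rw [Real.volume_Ioc]
      ring_nf
    rw [hIoc]
    exact measure_mono fun s hs =>
      ⟨two_add_two_mul_cos_lt_mul h0 hδ (by linarith) (abs_le.2 ⟨hs.1.le, hs.2⟩),
        by linarith [hs.1], by linarith [hs.2]⟩
  have hball : rotationBall δ = {u | (mat u).trace + 1 ∈ Set.Ioi (2 + 2 * Real.cos δ)} :=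
    Set.ext fun g => mem_rotationBall_iff h0 hδ g
  have hfubini : ENNReal.ofReal (δ / 2 * (c * (δ ^ 2 / 20))) ≤
      ENNReal.ofReal (haarSO3.real (rotationBall δ) * (2 * Real.pi)) := by
    rw [ENNReal.ofReal_mul measureReal_nonneg, ofReal_measureReal, hball,
      haarSO3_trace_add_one_mem measurableSet_Ioi, ENNReal.ofReal_mul (by positivity)]
    calc _ ≤ ENNReal.ofReal (δ / 2) * haarSO3 {g | 1 - δ ^ 2 / 20 ≤ mat g 0 0} := by
          gcongr
          exact hcap _ (by positivity) (by nlinarith [Real.pi_lt_d2])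
      _ = ∫⁻ _ in {g | 1 - δ ^ 2 / 20 ≤ mat g 0 0}, ENNReal.ofReal (δ / 2) ∂haarSO3 := by
          rw [setLIntegral_const]
      _ ≤ _ := (setLIntegral_mono' (measurableSet_le measurable_const
            (continuous_entry 0 0).measurable) hsection).trans (setLIntegral_le_lintegral _ _)
  rw [ENNReal.ofReal_le_ofReal_iff (by positivity)] at hfubini
  rw [div_mul_eq_mul_div, div_le_iff₀ (by positivity)]
  linarith

theorem haarSO3_real_rotationBall_pos {δ : ℝ} (hδ : 0 < δ) : 0 < haarSO3.real (rotationBall δ) := by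
  rcases le_or_gt δ Real.pi with h | h
  · obtain ⟨c, hc, hcb⟩ := exists_le_haarSO3_rotationBall
    exact lt_of_lt_of_le (by positivity) (hcb δ hδ h)
  · rw [rotationBall_eq_univ h, probReal_univ]
    exact one_pos

theorem haarSO3_rotationBall_ne_zero {δ : ℝ} (hδ : 0 < δ) : haarSO3 (rotationBall δ) ≠ 0 := fun h =>
  (haarSO3_real_rotationBall_pos hδ).ne' (by rw [measureReal_def, h, ENNReal.toReal_zero])

/-! ### The noise -/

instance (δ : ℝ) : IsZeroOrProbabilityMeasure (noise δ) :=
  inferInstanceAs (IsZeroOrProbabilityMeasure (ProbabilityTheory.cond _ _))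

theorem isProbabilityMeasure_noise {δ : ℝ} (hδ : 0 < δ) : IsProbabilityMeasure (noise δ) :=
  ProbabilityTheory.cond_isProbabilityMeasure (haarSO3_rotationBall_ne_zero hδ)

/-- The `ℓ¹` distance of the matrices of two rotations, used as a modulus of continuity for the
noise. -/
def frameGap (x y : SO3) : ℝ := ∑ i, ∑ j, |mat x i j - mat y i j|

theorem frameGap_nonneg (x y : SO3) : 0 ≤ frameGap x y :=
  Finset.sum_nonneg fun _ _ => Finset.sum_nonneg fun _ _ => abs_nonneg _

theorem frameGap_self (x : SO3) : frameGap x x = 0 := by simp [frameGap]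

theorem continuous_frameGap : Continuous fun a : SO3 × SO3 => frameGap a.1 a.2 := by
  refine continuous_finsetSum _ fun i _ => continuous_finsetSum _ fun j _ => ?_
  exact (((continuous_entry i j).comp continuous_fst).sub
    ((continuous_entry i j).comp continuous_snd)).abs

theorem abs_trace_sub_le (b g x y : SO3) :
    |(mat (b * (g * x)⁻¹)).trace - (mat (b * (g * y)⁻¹)).trace| ≤ frameGap x y := by
  have htrace (z : SO3) : (mat (b * (g * z)⁻¹)).trace =
      ∑ i, ∑ j, mat (g⁻¹ * b) i j * mat z i j := by
    rw [mul_inv_rev, ← mul_assoc, mat_mul, Matrix.trace_mul_comm, ← mat_mul, ← mul_assoc, mat_mul,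
      mat_inv z]
    simp [Matrix.trace, Matrix.mul_apply]
  simp only [htrace, ← Finset.sum_sub_distrib, ← mul_sub]
  refine (Finset.abs_sum_le_sum_abs _ _).trans (Finset.sum_le_sum fun i _ =>
    (Finset.abs_sum_le_sum_abs _ _).trans (Finset.sum_le_sum fun j _ => ?_))
  rw [abs_mul]
  exact mul_le_of_le_one_left (abs_nonneg _) (abs_entry_le_one _ _ _)

/-- The translate `U_δ x` of the ball of radius `δ`, on which `u x` is uniformly distributed when
`u` is distributed according to the noise. -/
def noiseBall (δ : ℝ) (x : SO3) : Set SO3 := (· * x⁻¹) ⁻¹' rotationBall δ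

theorem measurableSet_noiseBall (δ : ℝ) (x : SO3) : MeasurableSet (noiseBall δ x) :=
  measurable_mul_const x⁻¹ (measurableSet_rotationBall δ)

theorem integral_noise_mul (δ : ℝ) (F : SO3 → ℝ) (x : SO3) :
    ∫ u, F (u * x) ∂noise δ =
      (haarSO3.real (rotationBall δ))⁻¹ * ∫ b in noiseBall δ x, F b ∂haarSO3 := by
  have hset : (· * x) ⁻¹' noiseBall δ x = rotationBall δ := by
    simp only [noiseBall, ← Set.preimage_comp, Function.comp_def, mul_inv_cancel_right,
      Set.preimage_id']
  rw [noise, ProbabilityTheory.cond, integral_smul_measure, ENNReal.toReal_inv, smul_eq_mul,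
    ← measureReal_def, ← hset]
  congr 1
  exact (measurePreserving_mul_right haarSO3 x).setIntegral_preimage_emb
    (measurableEmbedding_mulRight x) F _

theorem abs_setIntegral_sub_le {α : Type*} [MeasurableSpace α] {μ : Measure α} [IsFiniteMeasure μ]
    {F : α → ℝ} (hF : Integrable F μ) {M : ℝ} (hM : ∀ a, |F a| ≤ M) {s t : Set α}
    (hs : MeasurableSet s) (ht : MeasurableSet t) :
    |∫ a in s, F a ∂μ - ∫ a in t, F a ∂μ| ≤ M * μ.real (symmDiff s t) := by
  have hsplit : ∫ a in s, F a ∂μ - ∫ a in t, F a ∂μ =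
      ∫ a in s \ t, F a ∂μ - ∫ a in t \ s, F a ∂μ := by
    rw [← integral_inter_add_sdiff ht hF.integrableOn,
      ← integral_inter_add_sdiff (s := t) hs hF.integrableOn, Set.inter_comm t s]
    ring
  have hbound (r : Set α) : |∫ a in r, F a ∂μ| ≤ M * μ.real r :=
    norm_setIntegral_le_of_norm_le_const (measure_lt_top _ _) fun a _ =>
      (Real.norm_eq_abs _).trans_le (hM a)
  rw [hsplit, measureReal_symmDiff_eq hs ht, mul_add]
  exact (abs_sub _ _).trans (add_le_add (hbound _) (hbound _))

theorem abs_integral_noise_sub_le (δ : ℝ) {F : SO3 → ℝ} (hF : Measurable F) {M : ℝ}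
    (hM : ∀ b, |F b| ≤ M) (x y : SO3) :
    |∫ u, F (u * x) ∂noise δ - ∫ u, F (u * y) ∂noise δ| ≤ (haarSO3.real (rotationBall δ))⁻¹ *
      (M * haarSO3.real (symmDiff (noiseBall δ x) (noiseBall δ y))) := by
  rw [integral_noise_mul, integral_noise_mul, ← mul_sub, abs_mul, abs_of_nonneg (by positivity)]
  exact mul_le_mul_of_nonneg_left (abs_setIntegral_sub_le
    (.of_bound hF.aestronglyMeasurable M (ae_of_all _ hM)) hM (measurableSet_noiseBall δ x)
    (measurableSet_noiseBall δ y)) (by positivity)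

/-- Points of the symmetric difference have a trace relative to `g x` in a band of width
`2 * frameGap x y` around the trace defining the ball. -/
theorem exists_haarSO3_symmDiff_noiseBall_le : ∃ C : ℝ, 0 < C ∧ ∀ δ : ℝ, 0 < δ → ∀ g x y : SO3,
    haarSO3.real (symmDiff (noiseBall δ (g * x)) (noiseBall δ (g * y))) ≤
      C * √(frameGap x y) := by
  obtain ⟨C, hC, hband⟩ := exists_haarSO3_trace_band_le
  refine ⟨C, hC, fun δ hδ g x y => ?_⟩
  rcases le_or_gt δ Real.pi with h | h
  · let B : Set SO3 := {u | (mat u).trace + 1 ∈ Set.Icc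
      (2 + 2 * Real.cos δ - frameGap x y) (2 + 2 * Real.cos δ + frameGap x y)}
    have hsub : symmDiff (noiseBall δ (g * x)) (noiseBall δ (g * y)) ⊆ (· * (g * x)⁻¹) ⁻¹' B := by
      intro b hb
      have hgap := abs_le.1 (abs_trace_sub_le b g x y)
      simp only [noiseBall, Set.mem_symmDiff, Set.mem_preimage, mem_rotationBall_iff hδ h,
        not_lt] at hb
      rcases hb with ⟨hx, hy⟩ | ⟨hy, hx⟩ <;> constructor <;> linarith
    refine ENNReal.toReal_le_of_le_ofReal (by positivity) ((measure_mono hsub).trans ?_)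
    rw [measure_preimage_mul_right]
    exact hband _ _ (frameGap_nonneg x y)
  · simp only [noiseBall, rotationBall_eq_univ h, Set.preimage_univ, symmDiff_self,
      Set.bot_eq_empty, measureReal_empty]
    positivity

theorem noise_preimage_le (δ : ℝ) (B : Set SO3) (x : SO3) :
    noise δ {u | u * x ∈ B} ≤ (haarSO3 (rotationBall δ))⁻¹ * haarSO3 B := by
  rw [noise, ProbabilityTheory.cond_apply (measurableSet_rotationBall δ)]
  exact mul_le_mul_right ((measure_mono Set.inter_subset_right).trans
    (measure_preimage_mul_right haarSO3 x B).le) _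

/-! ### A mean ergodic theorem -/

section MeanErgodic

variable {𝕜 E : Type*} [RCLike 𝕜] [NormedAddCommGroup E] [NormedSpace 𝕜 E] {T : E →L[𝕜] E}

theorem norm_iterate_apply_le (hT : ‖T‖ ≤ 1) (k : ℕ) (x : E) : ‖T^[k] x‖ ≤ ‖x‖ := by
  induction k with
  | zero => rfl
  | succ k ih =>
    rw [Function.iterate_succ_apply']
    exact ((T.le_of_opNorm_le hT _).trans_eq (one_mul _)).trans ih

theorem norm_birkhoffAverage_id_le (hT : ‖T‖ ≤ 1) (n : ℕ) (x : E) :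
    ‖birkhoffAverage 𝕜 T _root_.id n x‖ ≤ ‖x‖ := by
  rw [birkhoffAverage, norm_smul, norm_inv, RCLike.norm_natCast]
  refine inv_mul_le_of_le_mul₀ n.cast_nonneg (norm_nonneg _) ?_
  calc ‖birkhoffSum T _root_.id n x‖ ≤ ∑ _k ∈ Finset.range n, ‖x‖ :=
        norm_sum_le_of_le _ fun k _ => norm_iterate_apply_le hT k x
    _ = n * ‖x‖ := by rw [Finset.sum_const, Finset.card_range, nsmul_eq_mul]

theorem birkhoffAverage_id_map_sub (T : E →L[𝕜] E) (n : ℕ) (x y : E) :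
    birkhoffAverage 𝕜 T _root_.id n (x - y) =
      birkhoffAverage 𝕜 T _root_.id n x - birkhoffAverage 𝕜 T _root_.id n y := by
  simp only [birkhoffAverage, birkhoffSum, id_eq, iterate_map_sub, Finset.sum_sub_distrib, smul_sub]

theorem map_birkhoffAverage_id (T : E →L[𝕜] E) (n : ℕ) (x : E) :
    T (birkhoffAverage 𝕜 T _root_.id n x) = birkhoffAverage 𝕜 T _root_.id n (T x) := by
  rw [map_birkhoffAverage 𝕜 𝕜]
  simp only [birkhoffAverage, birkhoffSum, Function.comp_apply, id_eq,
    ← Function.iterate_succ_apply', Function.iterate_succ_apply]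

theorem tendsto_birkhoffAverage_id_map_sub (hT : ‖T‖ ≤ 1) (x : E) :
    Tendsto (fun n => birkhoffAverage 𝕜 T _root_.id n (T x - x)) atTop (𝓝 0) := by
  simp only [birkhoffAverage_id_map_sub]
  refine tendsto_birkhoffAverage_apply_sub_birkhoffAverage 𝕜
    (isBounded_iff_forall_norm_le.2 ⟨‖x‖, ?_⟩)
  rintro _ ⟨k, rfl⟩
  exact norm_iterate_apply_le hT k x

theorem tendsto_birkhoffAverage_id_of_mem_closure_range (hT : ‖T‖ ≤ 1) {x : E}
    (hx : x ∈ closure ((T.toLinearMap - LinearMap.id).range : Set E)) :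
    Tendsto (fun n => birkhoffAverage 𝕜 T _root_.id n x) atTop (𝓝 0) := by
  have hclosed : IsClosed {x : E | Tendsto (birkhoffAverage 𝕜 T _root_.id · x) atTop (𝓝 0)} :=
    isClosed_setOfPred_tendsto_birkhoffAverage 𝕜 (T.lipschitz.weaken hT) uniformContinuous_id
      continuous_const
  refine closure_minimal ?_ hclosed hx
  rintro _ ⟨z, rfl⟩
  exact tendsto_birkhoffAverage_id_map_sub hT z

theorem birkhoffAverage_id_sub_mem_range (T : E →L[𝕜] E) {n : ℕ} (hn : n ≠ 0) (x : E) :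
    birkhoffAverage 𝕜 T _root_.id n x - x ∈ (T.toLinearMap - LinearMap.id).range := by
  have hiter (k : ℕ) : T^[k] x - x ∈ (T.toLinearMap - LinearMap.id).range := by
    induction k with
    | zero => simp
    | succ k ih =>
      rw [Function.iterate_succ_apply', ← sub_add_sub_cancel _ (T^[k] x)]
      exact Submodule.add_mem _ ⟨T^[k] x, rfl⟩ ih
  have hsum : birkhoffAverage 𝕜 T _root_.id n x - x =
      (n : 𝕜)⁻¹ • ∑ k ∈ Finset.range n, (T^[k] x - x) := by
    rw [Finset.sum_sub_distrib, smul_sub, Finset.sum_const, Finset.card_range,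
      ← Nat.cast_smul_eq_nsmul 𝕜, inv_smul_smul₀ (Nat.cast_ne_zero.2 hn)]
    rfl
  rw [hsum]
  exact Submodule.smul_mem _ _ (Submodule.sum_mem _ fun k _ => hiter k)

/-- A cluster point `y` of the averages is fixed by `T`, and the averages converge to `0` on
`y - x`, which lies in the closure of the range of `T - 1`. -/
theorem exists_isFixedPt_tendsto_birkhoffAverage_id (hT : ‖T‖ ≤ 1) {K : Set E} (hK : IsCompact K)
    {x : E} (hx : ∀ n, birkhoffAverage 𝕜 T _root_.id n x ∈ K) :
    ∃ y, T y = y ∧ Tendsto (fun n => birkhoffAverage 𝕜 T _root_.id n x) atTop (𝓝 y) := by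
  obtain ⟨y, -, φ, hφ, hy⟩ := hK.tendsto_subseq hx
  have hfix : T y = y := by
    have hlim := ((T.continuous.tendsto y).comp hy).sub hy
    simp only [Function.comp_def, map_birkhoffAverage_id, ← birkhoffAverage_id_map_sub] at hlim
    exact sub_eq_zero.1 (tendsto_nhds_unique hlim
      ((tendsto_birkhoffAverage_id_map_sub hT x).comp hφ.tendsto_atTop))
  have hmem : y - x ∈ closure ((T.toLinearMap - LinearMap.id).range : Set E) := by
    refine mem_closure_of_tendsto (hy.sub_const x) ?_
    filter_upwards [eventually_gt_atTop 0] with n hn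
    exact birkhoffAverage_id_sub_mem_range T (hn.trans_le (hφ.id_le n)).ne' x
  have hlim := (Function.IsFixedPt.tendsto_birkhoffAverage 𝕜 hfix _root_.id).sub
    (tendsto_birkhoffAverage_id_of_mem_closure_range hT hmem)
  simp only [birkhoffAverage_id_map_sub, sub_sub_cancel, sub_zero, id_eq] at hlim
  exact ⟨y, hfix, hlim⟩

end MeanErgodic

/-! ### The process on frames -/

/-- One step of the `δ`-diffused process about `g f_ε` lifted to frames, which are encoded as
rotations: the law of `u g F_ε(x)`, where `F_ε` is the lift `twistFrame` of `f_ε`. -/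
def stepFrame (ε δ : ℝ) (g : SO3) (κ : Measure SO3) : Measure SO3 :=
  ((noise δ).prod κ).map fun a => a.1 * (g * twistFrame ε a.2)

theorem continuous_mul_mul_twistFrame (ε : ℝ) (g : SO3) :
    Continuous fun a : SO3 × SO3 => a.1 * (g * twistFrame ε a.2) :=
  continuous_fst.mul (continuous_const.mul ((continuous_twistFrame ε).comp continuous_snd))

theorem isProbabilityMeasure_stepFrame (ε : ℝ) {δ : ℝ} (hδ : 0 < δ) (g : SO3) (κ : Measure SO3)
    [IsProbabilityMeasure κ] : IsProbabilityMeasure (stepFrame ε δ g κ) := by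
  have := isProbabilityMeasure_noise hδ
  exact Measure.isProbabilityMeasure_map (continuous_mul_mul_twistFrame ε g).measurable.aemeasurable

theorem isProbabilityMeasure_iterate_stepFrame (ε : ℝ) {δ : ℝ} (hδ : 0 < δ) (g : SO3) (k : ℕ) :
    IsProbabilityMeasure ((stepFrame ε δ g)^[k] haarSO3) := by
  induction k with
  | zero => exact inferInstanceAs (IsProbabilityMeasure haarSO3)
  | succ k ih =>
    rw [Function.iterate_succ_apply']
    exact isProbabilityMeasure_stepFrame ε hδ g _

theorem step_map_frameLine (ε δ : ℝ) (g : SO3) (κ : Measure SO3) [SFinite κ] :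
    step ε δ g (κ.map frameLine) = (stepFrame ε δ g κ).map frameLine := by
  have hline := continuous_frameLine.measurable
  have hstep : Measurable fun a : SO3 × PS2 =>
      rotateSharp a.1 (rotateSharp g (twistSharp ε a.2)) :=
    (continuous_fst.smul (((continuous_twistSharp ε).comp continuous_snd).const_smul g)).measurable
  have hprod : (noise δ).prod (κ.map frameLine) =
      ((noise δ).prod κ).map (Prod.map id frameLine) := by
    rw [← Measure.map_prod_map _ _ measurable_id hline, Measure.map_id]
  rw [step, hprod, Measure.map_map hstep (measurable_id.prodMap hline), stepFrame,
    Measure.map_map hline (continuous_mul_mul_twistFrame ε g).measurable]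
  congr 1
  funext a
  simp only [Function.comp_apply, Prod.map_fst, Prod.map_snd, id_eq, rotateSharp_eq_smul]
  rw [← frameLine_twistFrame]
  simp only [frameLine, mul_smul]

theorem iterate_step_liouville (ε : ℝ) {δ : ℝ} (hδ : 0 < δ) (g : SO3) (k : ℕ) :
    (step ε δ g)^[k] liouville = ((stepFrame ε δ g)^[k] haarSO3).map frameLine := by
  induction k with
  | zero => exact liouville_eq_map_frameLine
  | succ k ih =>
    have := isProbabilityMeasure_iterate_stepFrame ε hδ g k
    rw [Function.iterate_succ_apply', Function.iterate_succ_apply', ih, step_map_frameLine]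

/-- The Cesàro averages of the process on frames, started from Haar measure. -/
def cesaroFrame (ε δ : ℝ) (g : SO3) (n : ℕ) : Measure SO3 :=
  (n : ℝ≥0∞)⁻¹ • ∑ k ∈ Finset.Icc 1 n, (stepFrame ε δ g)^[k] haarSO3

theorem cesaro_eq_map (ε : ℝ) {δ : ℝ} (hδ : 0 < δ) (g : SO3) (n : ℕ) :
    cesaro ε δ g n = (cesaroFrame ε δ g n).map frameLine := by
  ext B hB
  rw [Measure.map_apply continuous_frameLine.measurable hB]
  simp only [cesaro, cesaroFrame, Measure.smul_apply, Measure.finsetSum_apply,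
    iterate_step_liouville ε hδ, Measure.map_apply continuous_frameLine.measurable hB]

theorem isProbabilityMeasure_cesaroFrame (ε : ℝ) {δ : ℝ} (hδ : 0 < δ) (g : SO3) {n : ℕ}
    (hn : n ≠ 0) : IsProbabilityMeasure (cesaroFrame ε δ g n) := by
  have := isProbabilityMeasure_iterate_stepFrame ε hδ g
  constructor
  simp only [cesaroFrame, Measure.smul_apply, Measure.finsetSum_apply, measure_univ,
    Finset.sum_const, Nat.card_Icc, add_tsub_cancel_right, smul_eq_mul, nsmul_eq_mul, mul_one]
  exact ENNReal.inv_mul_cancel (Nat.cast_ne_zero.2 hn) (ENNReal.natCast_ne_top n)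

theorem continuous_integral_noise (ε δ : ℝ) (g : SO3) (F : SO3 →ᵇ ℝ) :
    Continuous fun a => ∫ u, F (u * (g * twistFrame ε a)) ∂noise δ := by
  refine continuous_of_dominated (bound := fun _ => ‖F‖) (fun a => ?_)
    (fun a => ae_of_all _ fun u => F.norm_coe_le_norm _) (integrable_const _)
    (ae_of_all _ fun u => ?_)
  · exact (F.continuous.comp (continuous_mul_const _)).aestronglyMeasurable
  · exact F.continuous.comp ((continuous_mul_mul_twistFrame ε g).comp (Continuous.prodMk_right u))

theorem norm_integral_noise_le (ε δ : ℝ) (g : SO3) (F : SO3 →ᵇ ℝ) (a : SO3) :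
    ‖∫ u, F (u * (g * twistFrame ε a)) ∂noise δ‖ ≤ ‖F‖ :=
  (norm_integral_le_of_norm_le_const (ae_of_all _ fun _ => F.norm_coe_le_norm _)).trans
    (mul_le_of_le_one_right (norm_nonneg _) measureReal_le_one)

/-- The Markov operator of the process on frames, acting on continuous functions. -/
def diffuse (ε δ : ℝ) (g : SO3) : (SO3 →ᵇ ℝ) →L[ℝ] (SO3 →ᵇ ℝ) :=
  LinearMap.mkContinuous
    { toFun := fun F => BoundedContinuousFunction.ofNormedAddCommGroup
        (fun a => ∫ u, F (u * (g * twistFrame ε a)) ∂noise δ)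
        (continuous_integral_noise ε δ g F) ‖F‖ (norm_integral_noise_le ε δ g F)
      map_add' := fun F H => by
        ext a
        have hint (F : SO3 →ᵇ ℝ) :
            Integrable (fun u => F (u * (g * twistFrame ε a))) (noise δ) :=
          .of_bound (F.continuous.comp (continuous_mul_const _)).aestronglyMeasurable ‖F‖
            (ae_of_all _ fun u => F.norm_coe_le_norm _)
        exact integral_add (hint F) (hint H)
      map_smul' := fun c F => by
        ext a
        exact integral_const_mul c _ } 1 fun F => by
    rw [one_mul]
    exact BoundedContinuousFunction.norm_ofNormedAddCommGroup_le _ (norm_nonneg _)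
      (norm_integral_noise_le ε δ g F)

theorem diffuse_apply (ε δ : ℝ) (g : SO3) (F : SO3 →ᵇ ℝ) (a : SO3) :
    diffuse ε δ g F a = ∫ u, F (u * (g * twistFrame ε a)) ∂noise δ := rfl

theorem norm_diffuse_le (ε δ : ℝ) (g : SO3) : ‖diffuse ε δ g‖ ≤ 1 :=
  LinearMap.mkContinuous_norm_le _ zero_le_one _

theorem integral_stepFrame (ε δ : ℝ) (g : SO3) (κ : Measure SO3) [IsFiniteMeasure κ]
    (F : SO3 →ᵇ ℝ) : ∫ a, F a ∂stepFrame ε δ g κ = ∫ a, diffuse ε δ g F a ∂κ := by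
  have hcont := continuous_mul_mul_twistFrame ε g
  rw [stepFrame, integral_map hcont.measurable.aemeasurable F.continuous.aestronglyMeasurable,
    integral_prod_symm]
  · rfl
  · exact .of_bound (F.continuous.comp hcont).aestronglyMeasurable ‖F‖
      (ae_of_all _ fun u => F.norm_coe_le_norm _)

theorem integral_iterate_stepFrame (ε : ℝ) {δ : ℝ} (hδ : 0 < δ) (g : SO3) (k : ℕ) (F : SO3 →ᵇ ℝ) :
    ∫ a, F a ∂(stepFrame ε δ g)^[k] haarSO3 = ∫ a, (diffuse ε δ g)^[k] F a ∂haarSO3 := by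
  induction k generalizing F with
  | zero => rfl
  | succ k ih =>
    have := isProbabilityMeasure_iterate_stepFrame ε hδ g k
    rw [Function.iterate_succ_apply', integral_stepFrame, ih, Function.iterate_succ_apply]

theorem integral_cesaroFrame (ε : ℝ) {δ : ℝ} (hδ : 0 < δ) (g : SO3) (n : ℕ) (F : SO3 →ᵇ ℝ) :
    ∫ a, F a ∂cesaroFrame ε δ g n =
      (n : ℝ)⁻¹ * ∑ k ∈ Finset.Icc 1 n, ∫ a, (diffuse ε δ g)^[k] F a ∂haarSO3 := by
  have := isProbabilityMeasure_iterate_stepFrame ε hδ g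
  rw [cesaroFrame, integral_smul_measure,
    integral_finsetSum_measure fun k _ => F.integrable _]
  simp only [integral_iterate_stepFrame ε hδ, smul_eq_mul, ENNReal.toReal_inv,
    ENNReal.toReal_natCast]

theorem integral_cesaroFrame_eq_integral_birkhoffAverage (ε : ℝ) {δ : ℝ} (hδ : 0 < δ) (g : SO3)
    (n : ℕ) (F : SO3 →ᵇ ℝ) : ∫ a, F a ∂cesaroFrame ε δ g n =
      ∫ a, birkhoffAverage ℝ (diffuse ε δ g) _root_.id n (diffuse ε δ g F) a ∂haarSO3 := by
  have hshift : ∑ k ∈ Finset.Icc 1 n, ∫ a, (diffuse ε δ g)^[k] F a ∂haarSO3 =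
      ∑ k ∈ Finset.range n, ∫ a, (diffuse ε δ g)^[k + 1] F a ∂haarSO3 := by
    rw [Finset.range_eq_Ico, Finset.sum_Ico_add'
      (fun k => ∫ a, (diffuse ε δ g)^[k] F a ∂haarSO3) 0 n 1, zero_add,
      Finset.Ico_add_one_right_eq_Icc]
  rw [integral_cesaroFrame ε hδ, hshift]
  simp only [birkhoffAverage, birkhoffSum, id_eq, Function.iterate_succ_apply,
    BoundedContinuousFunction.coe_smul, BoundedContinuousFunction.coe_sum, Finset.sum_apply,
    smul_eq_mul, integral_const_mul]
  rw [integral_finsetSum _ fun k _ => BoundedContinuousFunction.integrable _ _]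

theorem dist_diffuse_le (ε δ : ℝ) (g : SO3) {F : SO3 →ᵇ ℝ} {M C : ℝ} (hF : ‖F‖ ≤ M)
    (hC : ∀ x y, haarSO3.real (symmDiff (noiseBall δ (g * x)) (noiseBall δ (g * y))) ≤
      C * √(frameGap x y)) (a b : SO3) :
    dist (diffuse ε δ g F a) (diffuse ε δ g F b) ≤ (haarSO3.real (rotationBall δ))⁻¹ *
      (M * (C * √(frameGap (twistFrame ε a) (twistFrame ε b)))) := by
  have hM : 0 ≤ M := (norm_nonneg F).trans hF
  refine (abs_integral_noise_sub_le δ F.continuous.measurable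
    (fun x => (F.norm_coe_le_norm x).trans hF) _ _).trans ?_
  gcongr
  exact hC _ _

theorem isCompact_closure_diffuse (ε : ℝ) {δ : ℝ} (hδ : 0 < δ) (g : SO3) (M : ℝ) :
    IsCompact (closure (diffuse ε δ g '' {F | ‖F‖ ≤ M})) := by
  obtain ⟨C, -, hC⟩ := exists_haarSO3_symmDiff_noiseBall_le
  refine BoundedContinuousFunction.arzela_ascoli (Set.Icc (-M) M) isCompact_Icc _ ?_ ?_
  · rintro _ a ⟨F, hF, rfl⟩
    exact abs_le.1 (((diffuse ε δ g F).norm_coe_le_norm a).trans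
      (((diffuse ε δ g).le_of_opNorm_le (norm_diffuse_le ε δ g) F).trans (by rwa [one_mul])))
  · intro a
    rw [Metric.equicontinuousAt_iff_right]
    intro r hr
    have hgap : Continuous fun b => √(frameGap (twistFrame ε a) (twistFrame ε b)) :=
      (continuous_frameGap.comp (continuous_const.prodMk (continuous_twistFrame ε))).sqrt
    have hlim := (((hgap.tendsto a).const_mul C).const_mul M).const_mul
      (haarSO3.real (rotationBall δ))⁻¹
    rw [frameGap_self, Real.sqrt_zero, mul_zero, mul_zero, mul_zero] at hlim
    filter_upwards [hlim.eventually (gt_mem_nhds hr)] with b hb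
    rintro ⟨_, F, hF, rfl⟩
    exact (dist_diffuse_le ε δ g hF (hC δ hδ g) a b).trans_lt hb

theorem exists_tendsto_birkhoffAverage_diffuse (ε : ℝ) {δ : ℝ} (hδ : 0 < δ) (g : SO3)
    (F : SO3 →ᵇ ℝ) : ∃ H, diffuse ε δ g H = H ∧ Tendsto (fun n =>
      birkhoffAverage ℝ (diffuse ε δ g) _root_.id n (diffuse ε δ g F)) atTop (𝓝 H) := by
  refine exists_isFixedPt_tendsto_birkhoffAverage_id (norm_diffuse_le ε δ g)
    (isCompact_closure_diffuse ε hδ g ‖F‖) fun n => subset_closure ?_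
  exact ⟨birkhoffAverage ℝ (diffuse ε δ g) _root_.id n F,
    norm_birkhoffAverage_id_le (norm_diffuse_le ε δ g) n F, map_birkhoffAverage_id _ n F⟩

theorem continuous_integral_boundedContinuousFunction {X : Type*} [TopologicalSpace X]
    [MeasurableSpace X] [OpensMeasurableSpace X] (μ : Measure X) [IsProbabilityMeasure μ] :
    Continuous fun F : X →ᵇ ℝ => ∫ a, F a ∂μ := by
  refine (LipschitzWith.of_dist_le_mul (K := 1) fun F H => ?_).continuous
  rw [dist_eq_norm, ← integral_sub (F.integrable _) (H.integrable _), NNReal.coe_one, one_mul,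
    dist_eq_norm]
  exact (F - H).norm_integral_le_norm μ

theorem exists_forall_integral_eq_of_tendsto {X : Type*} [TopologicalSpace X] [CompactSpace X]
    [T2Space X] [MeasurableSpace X] [BorelSpace X] (P : ℕ → ProbabilityMeasure X)
    {I : (X →ᵇ ℝ) → ℝ}
    (hI : ∀ F : X →ᵇ ℝ, Tendsto (fun n => ∫ x, F x ∂(P n : Measure X)) atTop (𝓝 (I F))) :
    ∃ κ : ProbabilityMeasure X, ∀ F : X →ᵇ ℝ, ∫ x, F x ∂(κ : Measure X) = I F := by
  obtain ⟨κ, hκ⟩ : ∃ κ, MapClusterPt κ atTop P := exists_clusterPt_of_compactSpace _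
  refine ⟨κ, fun F => ?_⟩
  have hcluster : MapClusterPt (∫ x, F x ∂(κ : Measure X)) atTop
      (fun n => ∫ x, F x ∂(P n : Measure X)) :=
    hκ.continuousAt_comp
      (ProbabilityMeasure.continuous_integral_boundedContinuousFunction F).continuousAt
  exact eq_of_nhds_neBot (hcluster.neBot.mono (inf_le_inf_left _ (hI F)))

theorem exists_stationary_tendsto_cesaroFrame (ε : ℝ) {δ : ℝ} (hδ : 0 < δ) (g : SO3) :
    ∃ κ : Measure SO3, IsProbabilityMeasure κ ∧ stepFrame ε δ g κ = κ ∧ ∀ F : SO3 →ᵇ ℝ,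
      Tendsto (fun n => ∫ a, F a ∂cesaroFrame ε δ g n) atTop (𝓝 (∫ a, F a ∂κ)) := by
  choose H hH hlim using exists_tendsto_birkhoffAverage_diffuse ε hδ g
  have hcesaro (F : SO3 →ᵇ ℝ) : Tendsto (fun n => ∫ a, F a ∂cesaroFrame ε δ g n) atTop
      (𝓝 (∫ a, H F a ∂haarSO3)) := by
    simp only [integral_cesaroFrame_eq_integral_birkhoffAverage ε hδ]
    exact ((continuous_integral_boundedContinuousFunction haarSO3).tendsto _).comp (hlim F)
  obtain ⟨κ, hκ⟩ := exists_forall_integral_eq_of_tendsto (fun n => ⟨cesaroFrame ε δ g (n + 1),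
    isProbabilityMeasure_cesaroFrame ε hδ g n.succ_ne_zero⟩) fun F =>
      (hcesaro F).comp (tendsto_add_atTop_nat 1)
  refine ⟨κ, inferInstance, ?_, fun F => by rw [hκ]; exact hcesaro F⟩
  have hlimit (F : SO3 →ᵇ ℝ) : H (diffuse ε δ g F) = H F := by
    refine tendsto_nhds_unique (hlim (diffuse ε δ g F)) ?_
    have hmap := ((diffuse ε δ g).continuous.tendsto _).comp (hlim F)
    simpa only [Function.comp_def, map_birkhoffAverage_id, hH] using hmap
  have := isProbabilityMeasure_stepFrame ε hδ g (κ : Measure SO3)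
  refine ext_of_forall_integral_eq_of_IsFiniteMeasure fun F => ?_
  rw [integral_stepFrame, hκ, hκ, hlimit]

/-! ### The stationary measures -/

theorem stepFrame_apply (ε δ : ℝ) (g : SO3) (κ : Measure SO3) [SFinite κ] {B : Set SO3}
    (hB : MeasurableSet B) : stepFrame ε δ g κ B =
      ∫⁻ a, noise δ {u | u * (g * twistFrame ε a) ∈ B} ∂κ := by
  have hstep := (continuous_mul_mul_twistFrame ε g).measurable
  rw [stepFrame, Measure.map_apply hstep hB, Measure.prod_apply_symm (hstep hB)]
  rfl

theorem stepFrame_le (ε δ : ℝ) (g : SO3) (κ : Measure SO3) [IsProbabilityMeasure κ] :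
    stepFrame ε δ g κ ≤ (haarSO3 (rotationBall δ))⁻¹ • haarSO3 := by
  refine Measure.le_iff.2 fun B hB => ?_
  rw [stepFrame_apply ε δ g κ hB, Measure.smul_apply, smul_eq_mul]
  refine (lintegral_mono fun a => noise_preimage_le δ B _).trans_eq ?_
  rw [lintegral_const, measure_univ, mul_one]

theorem framePoint_twistFrame (ε : ℝ) (g : SO3) :
    framePoint (twistFrame ε g) = twistS2 ε (framePoint g) :=
  Subtype.ext (framePoint_frame _)

theorem map_framePoint_stepFrame (ε : ℝ) {δ : ℝ} (hδ : 0 < δ) (g : SO3) {κ : Measure SO3}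
    [SFinite κ] (hκ : κ.map framePoint = area) : (stepFrame ε δ g κ).map framePoint = area := by
  have := isProbabilityMeasure_noise hδ
  have hpoint := continuous_framePoint.measurable
  have htwist := (continuous_twistS2 ε).measurable
  have hbase : κ.map (fun a => g • twistS2 ε (framePoint a)) = area := by
    refine (Measure.map_map (measurable_const_smul g) (htwist.comp hpoint)).symm.trans ?_
    rw [← Measure.map_map htwist hpoint, hκ, map_twistS2_area, MeasureTheory.map_smul]
  have hbase_meas : Measurable fun a => g • twistS2 ε (framePoint a) :=
    (htwist.comp hpoint).const_smul g
  calc (stepFrame ε δ g κ).map framePoint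
      = ((noise δ).prod κ).map fun a => a.1 • g • twistS2 ε (framePoint a.2) := by
        rw [stepFrame, Measure.map_map hpoint (continuous_mul_mul_twistFrame ε g).measurable]
        congr 1
        funext a
        simp only [Function.comp_apply, ← framePoint_twistFrame]
        simp only [framePoint, mul_smul]
    _ = ((noise δ).prod area).map fun a => a.1 • a.2 := by
        rw [← hbase]
        nth_rw 2 [← Measure.map_id (μ := noise δ)]
        rw [Measure.map_prod_map _ _ measurable_id hbase_meas,
          Measure.map_map measurable_smul_prod (measurable_id.prodMap hbase_meas)]
        rfl
    _ = area := map_smul_prod_of_smulInvariant _ _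

theorem map_framePoint_iterate_stepFrame (ε : ℝ) {δ : ℝ} (hδ : 0 < δ) (g : SO3) (k : ℕ) :
    ((stepFrame ε δ g)^[k] haarSO3).map framePoint = area := by
  induction k with
  | zero => exact area_eq_map_framePoint.symm
  | succ k ih =>
    have := isProbabilityMeasure_iterate_stepFrame ε hδ g k
    rw [Function.iterate_succ_apply']
    exact map_framePoint_stepFrame ε hδ g ih

theorem map_framePoint_cesaroFrame (ε : ℝ) {δ : ℝ} (hδ : 0 < δ) (g : SO3) {n : ℕ} (hn : n ≠ 0) :
    (cesaroFrame ε δ g n).map framePoint = area := by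
  have hpoint := continuous_framePoint.measurable
  ext B hB
  have hiterate (k : ℕ) : (stepFrame ε δ g)^[k] haarSO3 (framePoint ⁻¹' B) = area B := by
    rw [← Measure.map_apply hpoint hB, map_framePoint_iterate_stepFrame ε hδ]
  rw [Measure.map_apply hpoint hB]
  simp only [cesaroFrame, Measure.smul_apply, Measure.finsetSum_apply, hiterate,
    Finset.sum_const, Nat.card_Icc, add_tsub_cancel_right, smul_eq_mul, nsmul_eq_mul]
  exact ENNReal.inv_mul_cancel_left (Nat.cast_ne_zero.2 hn) (ENNReal.natCast_ne_top n)

/-- The limit of the Cesàro averages on frames, a lift of `m_{g,ε,δ}`. -/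
def frameLimit (ε : ℝ) {δ : ℝ} (hδ : 0 < δ) (g : SO3) : Measure SO3 :=
  (exists_stationary_tendsto_cesaroFrame ε hδ g).choose

section FrameLimit

variable (ε : ℝ) {δ : ℝ} (hδ : 0 < δ) (g : SO3)

instance isProbabilityMeasure_frameLimit : IsProbabilityMeasure (frameLimit ε hδ g) :=
  (exists_stationary_tendsto_cesaroFrame ε hδ g).choose_spec.1

theorem stepFrame_frameLimit : stepFrame ε δ g (frameLimit ε hδ g) = frameLimit ε hδ g :=
  (exists_stationary_tendsto_cesaroFrame ε hδ g).choose_spec.2.1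

theorem tendsto_cesaroFrame (F : SO3 →ᵇ ℝ) :
    Tendsto (fun n => ∫ a, F a ∂cesaroFrame ε δ g n) atTop (𝓝 (∫ a, F a ∂frameLimit ε hδ g)) :=
  (exists_stationary_tendsto_cesaroFrame ε hδ g).choose_spec.2.2 F

theorem frameLimit_le : frameLimit ε hδ g ≤ (haarSO3 (rotationBall δ))⁻¹ • haarSO3 :=
  (stepFrame_frameLimit ε hδ g).symm.trans_le (stepFrame_le ε δ g _)

theorem frameLimit_absolutelyContinuous : frameLimit ε hδ g ≪ haarSO3 :=
  (Measure.absolutelyContinuous_of_le (frameLimit_le ε hδ g)).trans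
    Measure.smul_absolutelyContinuous

theorem map_framePoint_frameLimit : (frameLimit ε hδ g).map framePoint = area := by
  have hpoint := continuous_framePoint.measurable
  have := Measure.isProbabilityMeasure_map (μ := frameLimit ε hδ g) hpoint.aemeasurable
  refine ext_of_forall_integral_eq_of_IsFiniteMeasure fun F => ?_
  rw [integral_map hpoint.aemeasurable F.continuous.aestronglyMeasurable]
  refine tendsto_nhds_unique
    (tendsto_cesaroFrame ε hδ g (F.compContinuous ⟨framePoint, continuous_framePoint⟩)) ?_
  refine tendsto_const_nhds.congr' ?_
  filter_upwards [eventually_ne_atTop 0] with n hn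
  rw [← map_framePoint_cesaroFrame ε hδ g hn,
    integral_map hpoint.aemeasurable F.continuous.aestronglyMeasurable]
  rfl

theorem isCesaroLimit_map_frameLimit :
    IsCesaroLimit ε δ g ((frameLimit ε hδ g).map frameLine) := by
  have hline := continuous_frameLine.measurable
  refine ⟨Measure.isProbabilityMeasure_map hline.aemeasurable, fun F => ?_⟩
  simp only [cesaro_eq_map ε hδ,
    integral_map hline.aemeasurable F.continuous.aestronglyMeasurable]
  exact tendsto_cesaroFrame ε hδ g (F.compContinuous ⟨frameLine, continuous_frameLine⟩)

theorem diffusedMeasure_eq_map_frameLimit :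
    diffusedMeasure ε δ g = (frameLimit ε hδ g).map frameLine := by
  have hlim := isCesaroLimit_map_frameLimit ε hδ g
  have hex : ∃ κ, IsCesaroLimit ε δ g κ := ⟨_, hlim⟩
  rw [diffusedMeasure, dif_pos hex]
  have := hex.choose_spec.1
  have := hlim.1
  exact ext_of_forall_integral_eq_of_IsFiniteMeasure fun F =>
    tendsto_nhds_unique (hex.choose_spec.2 F) (hlim.2 F)

end FrameLimit

theorem isDiffusedStationary (ε : ℝ) {δ : ℝ} (hδ : 0 < δ) (g : SO3) :
    IsDiffusedStationary ε δ g (diffusedMeasure ε δ g) := by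
  rw [diffusedMeasure_eq_map_frameLimit ε hδ]
  have hline := continuous_frameLine.measurable
  refine ⟨Measure.isProbabilityMeasure_map hline.aemeasurable, ?_, ?_, ?_⟩
  · rw [step_map_frameLine, stepFrame_frameLimit]
  · rw [liouville_eq_map_frameLine]
    exact (frameLimit_absolutelyContinuous ε hδ g).map hline
  · rw [Measure.map_map continuous_proj.measurable hline]
    exact map_framePoint_frameLimit ε hδ g

theorem measurable_of_forall_measurable_integral {X Y : Type*} [MeasurableSpace X]
    [TopologicalSpace Y] [HasOuterApproxClosed Y] [MeasurableSpace Y] [BorelSpace Y]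
    {κ : X → Measure Y} [∀ x, IsProbabilityMeasure (κ x)]
    (h : ∀ F : Y →ᵇ ℝ, Measurable fun x => ∫ y, F y ∂κ x) : Measurable κ := by
  refine Measurable.measure_of_isPiSystem_of_isProbabilityMeasure
    (S := {s | IsClosed s}) (by rw [‹BorelSpace Y›.measurable_eq, borel_eq_generateFrom_isClosed])
    isPiSystem_isClosed fun s hs => ?_
  refine measurable_of_tendsto_metrizable (f := fun n x => ∫⁻ y, IsClosed.apprSeq hs n y ∂κ x)
    (fun n => ?_) (tendsto_pi_nhds.2 fun x =>
      HasOuterApproxClosed.tendsto_lintegral_apprSeq hs (κ x))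
  have happrox := h ((IsClosed.apprSeq hs n).comp _ (NNReal.isometry_coe).lipschitz)
  convert happrox.ennreal_ofReal using 2 with x
  rw [← ENNReal.ofReal_toReal
      (BoundedContinuousFunction.lintegral_lt_top_of_nnreal (κ x) (IsClosed.apprSeq hs n)).ne,
    BoundedContinuousFunction.toReal_lintegral_coe_eq_integral]
  rfl

theorem measurable_integral_iterate_diffuse (ε δ : ℝ) (F : SO3 →ᵇ ℝ) (k : ℕ) :
    Measurable fun g => ∫ a, (diffuse ε δ g)^[k] F a ∂haarSO3 := by
  suffices h : StronglyMeasurable fun a : SO3 × SO3 => (diffuse ε δ a.1)^[k] F a.2 from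
    h.integral_prod_right'.measurable
  induction k with
  | zero => exact (F.continuous.comp continuous_snd).stronglyMeasurable
  | succ k ih =>
    simp only [Function.iterate_succ_apply', diffuse_apply]
    have hstep : Continuous fun b : (SO3 × SO3) × SO3 =>
        (b.1.1, b.2 * (b.1.1 * twistFrame ε b.1.2)) := by
      have := continuous_twistFrame ε
      fun_prop
    exact (ih.comp_measurable hstep.measurable).integral_prod_right'

theorem measurable_frameLimit (ε : ℝ) {δ : ℝ} (hδ : 0 < δ) : Measurable (frameLimit ε hδ) := by
  refine measurable_of_forall_measurable_integral fun F => ?_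
  refine measurable_of_tendsto_metrizable (f := fun n g => ∫ a, F a ∂cesaroFrame ε δ g n)
    (fun n => ?_) (tendsto_pi_nhds.2 fun g => tendsto_cesaroFrame ε hδ g F)
  simp only [integral_cesaroFrame ε hδ]
  exact (Finset.measurable_fun_sum _ fun k _ =>
    measurable_integral_iterate_diffuse ε δ F k).const_mul _

theorem averagedMeasure_apply (ε : ℝ) {δ : ℝ} (hδ : 0 < δ) {B : Set PS2} (hB : MeasurableSet B) :
    averagedMeasure ε δ B = ∫⁻ g, frameLimit ε hδ g (frameLine ⁻¹' B) ∂haarSO3 := by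
  have hline := continuous_frameLine.measurable
  have hdiffused : diffusedMeasure ε δ = fun g => (frameLimit ε hδ g).map frameLine :=
    funext (diffusedMeasure_eq_map_frameLimit ε hδ)
  have hmeas : Measurable fun g => (frameLimit ε hδ g).map frameLine :=
    (Measure.measurable_map _ hline).comp (measurable_frameLimit ε hδ)
  rw [averagedMeasure, hdiffused, Measure.bind_apply hB hmeas.aemeasurable]
  simp only [Measure.map_apply hline hB]

theorem isProbabilityMeasure_averagedMeasure (ε : ℝ) {δ : ℝ} (hδ : 0 < δ) :
    IsProbabilityMeasure (averagedMeasure ε δ) := by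
  constructor
  simp only [averagedMeasure_apply ε hδ MeasurableSet.univ, Set.preimage_univ, measure_univ,
    lintegral_one]

theorem averagedMeasure_absolutelyContinuous (ε : ℝ) {δ : ℝ} (hδ : 0 < δ) :
    averagedMeasure ε δ ≪ liouville := by
  refine Measure.AbsolutelyContinuous.mk fun B hB hzero => ?_
  rw [liouville_eq_map_frameLine, Measure.map_apply continuous_frameLine.measurable hB] at hzero
  simp only [averagedMeasure_apply ε hδ hB, frameLimit_absolutelyContinuous ε hδ _ hzero,
    lintegral_zero]

/-! ### The twist map makes tangent lines horizontal -/

theorem hasLineDerivAt_twist (ε : ℝ) (p v : E3) : HasLineDerivAt ℝ (twist ε)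
    (rotate (axisRotation (2 * Real.pi * (p 0 + 1 / 2) * ε))
      (v + (2 * Real.pi * ε * v 0) • !₂[0, -p 2, p 1])) p v := by
  have hcoord (i : Fin 3) : HasDerivAt (fun t : ℝ => p i + t * v i) (v i) 0 := by
    simpa using ((hasDerivAt_id (0 : ℝ)).mul_const (v i)).const_add (p i)
  have hangle : HasDerivAt (fun t : ℝ => 2 * Real.pi * (p 0 + t * v 0 + 1 / 2) * ε)
      (2 * Real.pi * ε * v 0) 0 :=
    ((((hcoord 0).add_const (1 / 2)).const_mul (2 * Real.pi)).mul_const ε).congr_deriv (by ring)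
  have hcomponent : HasDerivAt (fun t : ℝ => (twist ε (p + t • v)).ofLp)
      (rotate (axisRotation (2 * Real.pi * (p 0 + 1 / 2) * ε))
        (v + (2 * Real.pi * ε * v 0) • !₂[0, -p 2, p 1])).ofLp 0 := by
    refine hasDerivAt_pi.2 fun i => ?_
    rw [rotate_apply, mat_axisRotation]
    fin_cases i
    · exact (hcoord 0).congr_deriv (by simp)
    · refine ((hangle.cos.mul (hcoord 1)).sub (hangle.sin.mul (hcoord 2))).congr_deriv ?_
      simp
      ring
    · refine ((hangle.sin.mul (hcoord 1)).add (hangle.cos.mul (hcoord 2))).congr_deriv ?_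
      simp
      ring
  exact ((PiLp.continuousLinearEquiv 2 ℝ fun _ : Fin 3 => ℝ).symm.hasFDerivAt.comp_hasDerivAt 0
    hcomponent)

theorem fderiv_twist_apply (ε : ℝ) (p v : E3) : fderiv ℝ (twist ε) p v =
    rotate (axisRotation (2 * Real.pi * (p 0 + 1 / 2) * ε))
      (v + (2 * Real.pi * ε * v 0) • !₂[0, -p 2, p 1]) :=
  (differentiable_twist ε p).lineDeriv_eq_fderiv.symm.trans (hasLineDerivAt_twist ε p v).lineDeriv

theorem norm_sq_fderiv_twist (ε : ℝ) (p v : E3) : ‖fderiv ℝ (twist ε) p v‖ ^ 2 =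
    ‖v‖ ^ 2 + 2 * (2 * Real.pi * ε * v 0) * (p 1 * v 2 - p 2 * v 1) +
      (2 * Real.pi * ε * v 0) ^ 2 * (p 1 ^ 2 + p 2 ^ 2) := by
  rw [fderiv_twist_apply, norm_rotate, norm_sq_E3, norm_sq_E3]
  simp
  ring

theorem twist_one_sq_add_twist_two_sq (ε : ℝ) (p : E3) :
    twist ε p 1 ^ 2 + twist ε p 2 ^ 2 = p 1 ^ 2 + p 2 ^ 2 := by
  simp only [twist, Matrix.cons_val]
  linear_combination (p 1 ^ 2 + p 2 ^ 2) *
    Real.sin_sq_add_cos_sq (2 * Real.pi * (p 0 + 1 / 2) * ε)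

theorem inner_fderiv_twist_circle (ε : ℝ) (p v : E3) :
    inner ℝ (fderiv ℝ (twist ε) p v) !₂[0, -twist ε p 2, twist ε p 1] =
      p 1 * v 2 - p 2 * v 1 + 2 * Real.pi * ε * v 0 * (p 1 ^ 2 + p 2 ^ 2) := by
  have hrotate : (!₂[0, -twist ε p 2, twist ε p 1] : E3) =
      rotate (axisRotation (2 * Real.pi * (p 0 + 1 / 2) * ε)) !₂[0, -p 2, p 1] := by
    ext i
    rw [rotate_apply, mat_axisRotation]
    fin_cases i
    · simp
    · simp [twist]
    · simp [twist]
      ring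
  rw [hrotate, fderiv_twist_apply, inner_rotate, inner_E3]
  simp
  ring

theorem frameVector_one_sq_add_two_sq (g : SO3) :
    (frameVector g).1.1 1 ^ 2 + (frameVector g).1.1 2 ^ 2 =
      (mat g 0 1 ^ 2 + mat g 0 2 ^ 2) / 4 := by
  have hrow := row_inner g 0 0
  have hcol := col_inner g 0 0
  simp only [if_true] at hrow hcol
  rw [frameVector_fst_apply, frameVector_fst_apply]
  linear_combination (1 / 4 : ℝ) * (hcol - hrow)

theorem frameVector_cross (g : SO3) :
    (frameVector g).1.1 1 * (frameVector g).1.2 2 - (frameVector g).1.1 2 * (frameVector g).1.2 1 =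
      mat g 0 2 / 2 := by
  simp only [frameVector_fst_apply, frameVector_snd_apply]
  linear_combination -(1 / 2 : ℝ) * (col_two g).1

/-- The cosine of the angle between the image of the frame vector of `g` under the twist map and
the horizontal direction. -/
def twistCos (ε : ℝ) (g : SO3) : ℝ :=
  inner ℝ (twistT1 ε (frameVector g)).1.2 (horizontal (twistT1 ε (frameVector g)).1.1)

theorem norm_sq_fderiv_twist_frameVector (ε : ℝ) (g : SO3) :
    ‖fderiv ℝ (twist ε) (frameVector g).1.1 (frameVector g).1.2‖ ^ 2 =
      (1 + Real.pi * ε * mat g 0 1 * mat g 0 2) ^ 2 + (Real.pi * ε * mat g 0 1 ^ 2) ^ 2 := by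
  rw [norm_sq_fderiv_twist, frameVector_one_sq_add_two_sq, frameVector_cross,
    (frameVector g).2.2.1, frameVector_snd_apply]
  ring

theorem twistCos_eq (ε : ℝ) (g : SO3) (h : mat g 0 1 ≠ 0) :
    twistCos ε g = ‖fderiv ℝ (twist ε) (frameVector g).1.1 (frameVector g).1.2‖⁻¹ *
      ((√((mat g 0 1 ^ 2 + mat g 0 2 ^ 2) / 4))⁻¹ * (mat g 0 2 / 2 +
        Real.pi * ε * mat g 0 1 * (mat g 0 1 ^ 2 + mat g 0 2 ^ 2) / 2)) := by
  have hradius := (twist_one_sq_add_twist_two_sq ε (frameVector g).1.1).trans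
    (frameVector_one_sq_add_two_sq g)
  have hpole : ¬(twist ε (frameVector g).1.1 1 = 0 ∧ twist ε (frameVector g).1.1 2 = 0) := by
    rintro ⟨hone, htwo⟩
    rw [hone, htwo] at hradius
    have : 0 < mat g 0 1 ^ 2 := by positivity
    nlinarith [sq_nonneg (mat g 0 2)]
  change inner ℝ (_ • _) (horizontal (twist ε (frameVector g).1.1)) = _
  rw [horizontal, if_neg hpole, hradius, inner_smul_left, inner_smul_right,
    inner_fderiv_twist_circle, frameVector_one_sq_add_two_sq, frameVector_cross,
    frameVector_snd_apply, conj_trivial]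
  ring

theorem one_sub_twistCos_sq (ε : ℝ) (g : SO3) (h : mat g 0 1 ≠ 0) :
    1 - twistCos ε g ^ 2 = mat g 0 1 ^ 2 / ((mat g 0 1 ^ 2 + mat g 0 2 ^ 2) *
      ((1 + Real.pi * ε * mat g 0 1 * mat g 0 2) ^ 2 + (Real.pi * ε * mat g 0 1 ^ 2) ^ 2)) := by
  have : 0 < mat g 0 1 ^ 2 + mat g 0 2 ^ 2 := by positivity
  have hvector : (frameVector g).1.2 ≠ 0 := fun hzero => by
    simpa [hzero] using (frameVector g).2.2.1
  have hnorm := norm_pos_iff.2 (fderiv_twist_ne_zero ε (frameVector g).1.1 hvector)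
  rw [twistCos_eq ε g h, mul_pow, mul_pow, inv_pow, inv_pow, Real.sq_sqrt (by positivity),
    ← norm_sq_fderiv_twist_frameVector ε g]
  field_simp
  rw [norm_sq_fderiv_twist_frameVector]
  ring

theorem one_sub_twistCos_sq_le {ε : ℝ} (hε : ε ≠ 0) {g : SO3} (hone : mat g 0 1 ≠ 0)
    (htwo : mat g 0 2 ≠ 0) :
    1 - twistCos ε g ^ 2 ≤ 1 / (Real.pi * ε * mat g 0 1 * mat g 0 2) ^ 2 := by
  have hπ := Real.pi_ne_zero
  calc 1 - twistCos ε g ^ 2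
      ≤ mat g 0 1 ^ 2 / (mat g 0 2 ^ 2 * (Real.pi * ε * mat g 0 1 ^ 2) ^ 2) := by
        rw [one_sub_twistCos_sq ε g hone]
        gcongr
        · exact le_add_of_nonneg_left (sq_nonneg _)
        · exact le_add_of_nonneg_left (sq_nonneg _)
    _ = 1 / (Real.pi * ε * mat g 0 1 * mat g 0 2) ^ 2 := by field_simp

/-- The unit tangent vector at the same point in the horizontal direction which is closest to the
given one. -/
def nearestHorizontal (x : T1S2) : T1S2 :=
  ⟨(x.1.1, (if 0 ≤ inner ℝ x.1.2 (horizontal x.1.1) then (1 : ℝ) else -1) • horizontal x.1.1),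
    x.2.1, by split_ifs <;> simp [norm_horizontal],
    by rw [inner_smul_right, inner_horizontal, mul_zero]⟩

theorem mk_nearestHorizontal (x : T1S2) {p : S2} (hp : (p : E3) = x.1.1) :
    PS2.mk (nearestHorizontal x) = PS2.mk (horizontalVector p) := by
  refine Quotient.sound ⟨hp.symm, ?_⟩
  simp only [nearestHorizontal, horizontalVector, hp]
  split_ifs
  · exact Or.inl (one_smul _ _)
  · exact Or.inr (neg_one_smul _ _)

theorem norm_sub_nearestHorizontal_sq_le (x : T1S2) :
    ‖x.1.2 - (nearestHorizontal x).1.2‖ ^ 2 ≤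
      2 * (1 - inner ℝ x.1.2 (horizontal x.1.1) ^ 2) := by
  have hcos := abs_le.1 (abs_real_inner_le_norm x.1.2 (horizontal x.1.1))
  rw [x.2.2.1, norm_horizontal, mul_one] at hcos
  rw [norm_sub_sq_real, x.2.2.1, (nearestHorizontal x).2.2.1]
  simp only [nearestHorizontal, inner_smul_right]
  split_ifs <;> nlinarith

theorem abs_apply_le_norm (x : E3) (i : Fin 3) : |x i| ≤ ‖x‖ := by
  simpa using PiLp.norm_apply_le x i

theorem frameGap_frame_le {x y : T1S2} (h : x.1.1 = y.1.1) :
    frameGap (frame x) (frame y) ≤ 9 * ‖x.1.2 - y.1.2‖ := by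
  have hsnd (i : Fin 3) : |x.1.2 i - y.1.2 i| ≤ ‖x.1.2 - y.1.2‖ :=
    abs_apply_le_norm (x.1.2 - y.1.2) i
  have hfst (i : Fin 3) : |x.1.1 i| ≤ 1 / 2 := (abs_apply_le_norm x.1.1 i).trans x.2.1.le
  have hcross (i j : Fin 3) : |2 * (x.1.1 i * x.1.2 j - x.1.1 j * x.1.2 i) -
      2 * (x.1.1 i * y.1.2 j - x.1.1 j * y.1.2 i)| ≤ 2 * ‖x.1.2 - y.1.2‖ := by
    calc _ = |2 * (x.1.1 i * (x.1.2 j - y.1.2 j)) - 2 * (x.1.1 j * (x.1.2 i - y.1.2 i))| := by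
          ring_nf
      _ ≤ 2 * (|x.1.1 i| * |x.1.2 j - y.1.2 j|) + 2 * (|x.1.1 j| * |x.1.2 i - y.1.2 i|) := by
          refine (abs_sub _ _).trans_eq ?_
          simp only [abs_mul, abs_two]
      _ ≤ 2 * (1 / 2 * ‖x.1.2 - y.1.2‖) + 2 * (1 / 2 * ‖x.1.2 - y.1.2‖) := by
          gcongr <;> first | exact hfst _ | exact hsnd _
      _ = 2 * ‖x.1.2 - y.1.2‖ := by ring
  have hzero := hcross 1 2
  have hone := hcross 2 0
  have htwo := hcross 0 1
  simp only [h] at hzero hone htwo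
  simp only [frameGap, Fin.sum_univ_three, mat_frame, frameMat, h, Matrix.of_apply,
    Matrix.cons_val, Matrix.cons_val', sub_self, abs_zero]
  linarith [hsnd 0, hsnd 1, hsnd 2]

/-- The horizontal frame closest to the image `twistFrame ε g` of the frame `g`. -/
def horizontalFrame (ε : ℝ) (g : SO3) : SO3 :=
  frame (nearestHorizontal (twistT1 ε (frameVector g)))

theorem frameGap_horizontalFrame_le {ε : ℝ} (hε : 0 < ε) {g : SO3}
    (h : mat g 0 1 * mat g 0 2 ≠ 0) : frameGap (twistFrame ε g) (horizontalFrame ε g) ≤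
      9 * (ε * |mat g 0 1 * mat g 0 2|)⁻¹ := by
  have hgap := frameGap_frame_le (x := twistT1 ε (frameVector g))
    (y := nearestHorizontal (twistT1 ε (frameVector g))) rfl
  refine hgap.trans (mul_le_mul_of_nonneg_left ?_ (by norm_num))
  refine (abs_le_of_sq_le_sq' ?_ (by positivity)).2
  calc _ ≤ 2 * (1 - twistCos ε g ^ 2) := norm_sub_nearestHorizontal_sq_le _
    _ ≤ 2 * (1 / (Real.pi * ε * mat g 0 1 * mat g 0 2) ^ 2) := by
        gcongr
        exact one_sub_twistCos_sq_le hε.ne' (left_ne_zero_of_mul h) (right_ne_zero_of_mul h)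
    _ = 2 / Real.pi ^ 2 * ((ε * |mat g 0 1 * mat g 0 2|)⁻¹) ^ 2 := by
        rw [inv_pow, mul_pow ε, sq_abs]
        ring
    _ ≤ ((ε * |mat g 0 1 * mat g 0 2|)⁻¹) ^ 2 := by
        refine mul_le_of_le_one_left (sq_nonneg _) ?_
        rw [div_le_one (by positivity)]
        nlinarith [Real.pi_gt_three]

theorem ofReal_sqrt_frameGap_horizontalFrame_le {ε : ℝ} (hε : 0 < ε) (g : SO3) :
    ENNReal.ofReal √(frameGap (twistFrame ε g) (horizontalFrame ε g)) ≤
      ENNReal.ofReal (3 * ε ^ (-(1 / 2) : ℝ)) * weight (firstRow g) := by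
  rw [weight, firstRow_apply, firstRow_apply]
  have : 0 < ε ^ (-(1 / 2) : ℝ) := Real.rpow_pos_of_pos hε _
  rcases eq_or_ne (mat g 0 1 * mat g 0 2) 0 with hzero | hne
  · rw [hzero, abs_zero, ENNReal.ofReal_zero, ENNReal.zero_rpow_of_neg (by norm_num),
      ENNReal.mul_top (ENNReal.ofReal_pos.2 (by positivity)).ne']
    exact le_top
  have hpos := abs_pos.2 hne
  rw [ENNReal.ofReal_rpow_of_pos hpos, ← ENNReal.ofReal_mul (by positivity)]
  refine ENNReal.ofReal_le_ofReal ?_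
  calc √(frameGap (twistFrame ε g) (horizontalFrame ε g))
      ≤ √(3 ^ 2 * (ε * |mat g 0 1 * mat g 0 2|)⁻¹) :=
        Real.sqrt_le_sqrt ((frameGap_horizontalFrame_le hε hne).trans_eq (by norm_num))
    _ = 3 * ε ^ (-(1 / 2) : ℝ) * |mat g 0 1 * mat g 0 2| ^ (-(1 / 2) : ℝ) := by
        rw [Real.sqrt_mul (by norm_num), Real.sqrt_sq (by norm_num), mul_assoc,
          ← Real.mul_rpow hε.le hpos.le, Real.sqrt_inv, Real.sqrt_eq_rpow,
          Real.rpow_neg (by positivity)]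

/-! ### Comparison with Liouville measure -/

theorem lintegral_lintegral_smul_mem {G X Y : Type*} [Group G] [MeasurableSpace G]
    [MeasurableMul₂ G] [MulAction G X] [MulAction.IsPretransitive G X] [MeasurableSpace X]
    [MeasurableSMul₂ G X] [MeasurableSpace Y] (μ : Measure G) [SFinite μ] [μ.IsMulLeftInvariant]
    [μ.IsMulRightInvariant] (ν : Measure G) [IsProbabilityMeasure ν] (ρ : Measure Y)
    [IsProbabilityMeasure ρ] {σ : Y → X} (hσ : Measurable σ) (x₀ : X) {B : Set X}
    (hB : MeasurableSet B) :
    ∫⁻ g, ∫⁻ y, ν {u | (u * g) • σ y ∈ B} ∂ρ ∂μ = μ.map (· • x₀) B := by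
  have hfiber (u : G) (y : Y) : μ {g | (u * g) • σ y ∈ B} = μ.map (· • x₀) B := by
    obtain ⟨c, hc⟩ := MulAction.exists_smul_eq G x₀ (σ y)
    rw [Measure.map_apply (measurable_smul_const x₀) hB,
      ← measure_preimage_mul_right μ c ((· • x₀) ⁻¹' B),
      ← measure_preimage_mul μ u (_ ⁻¹' ((· • x₀) ⁻¹' B))]
    simp only [← hc, smul_smul, Set.preimage, Set.mem_ofPred_eq]
  have hset : MeasurableSet {a : (G × Y) × G | (a.2 * a.1.1) • σ a.1.2 ∈ B} :=
    (measurable_snd.mul measurable_fst.fst).smul (hσ.comp measurable_fst.snd) hB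
  have hslice (u : G) : (μ.prod ρ) {a | (u * a.1) • σ a.2 ∈ B} = μ.map (· • x₀) B := by
    refine (Measure.prod_apply_symm (measurable_prodMk_right hset)).trans ?_
    exact (lintegral_congr fun y => hfiber u y).trans (by simp)
  calc ∫⁻ g, ∫⁻ y, ν {u | (u * g) • σ y ∈ B} ∂ρ ∂μ
      = ∫⁻ a, ν {u | (u * a.1) • σ a.2 ∈ B} ∂μ.prod ρ :=
        (lintegral_prod _ (measurable_measure_prodMk_left hset).aemeasurable).symm
    _ = ∫⁻ u, (μ.prod ρ) {a | (u * a.1) • σ a.2 ∈ B} ∂ν :=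
        (Measure.prod_apply hset).symm.trans (Measure.prod_apply_symm hset)
    _ = μ.map (· • x₀) B := by simp [hslice]

/-- The horizontal line field: through each point of the sphere, the line tangent to the circle
of latitude, which the twist map shears every other line towards. -/
def horizontalLine (p : S2) : PS2 := PS2.mk (horizontalVector p)

theorem measurable_horizontalLine : Measurable horizontalLine :=
  continuous_mk.measurable.comp measurable_horizontalVector

theorem frameLine_horizontalFrame (ε : ℝ) (g : SO3) :
    frameLine (horizontalFrame ε g) = horizontalLine (twistS2 ε (framePoint g)) := by
  rw [← mk_frameVector, horizontalFrame, frameVector_frame]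
  refine mk_nearestHorizontal _ ?_
  rw [← framePoint_twistFrame, twistFrame, framePoint_frame]

theorem exists_noise_mul_mem_le : ∃ C : ℝ, 0 < C ∧ ∀ δ : ℝ, 0 < δ → ∀ g x y : SO3,
    ∀ A : Set SO3, MeasurableSet A → noise δ {u | u * (g * x) ∈ A} ≤
      noise δ {u | u * (g * y) ∈ A} +
        ENNReal.ofReal (C * (haarSO3.real (rotationBall δ))⁻¹) *
          ENNReal.ofReal √(frameGap x y) := by
  obtain ⟨C, hC, hball⟩ := exists_haarSO3_symmDiff_noiseBall_le
  refine ⟨C, hC, fun δ hδ g x y A hA => ?_⟩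
  have := isProbabilityMeasure_noise hδ
  have hindicator (z : SO3) : ∫ u, A.indicator (1 : SO3 → ℝ) (u * z) ∂noise δ =
      (noise δ).real {u | u * z ∈ A} :=
    integral_indicator_one (measurable_mul_const z hA)
  have hsub := abs_integral_noise_sub_le δ (F := A.indicator (1 : SO3 → ℝ))
    (measurable_one.indicator hA) (M := 1)
    (fun b => by by_cases hb : b ∈ A <;> simp [hb]) (g * x) (g * y)
  rw [hindicator, hindicator, one_mul] at hsub
  have hreal : (noise δ).real {u | u * (g * x) ∈ A} ≤ (noise δ).real {u | u * (g * y) ∈ A} +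
      C * (haarSO3.real (rotationBall δ))⁻¹ * √(frameGap x y) := by
    refine sub_le_iff_le_add'.1 ((le_abs_self _).trans (hsub.trans ?_))
    rw [mul_comm C, mul_assoc]
    exact mul_le_mul_of_nonneg_left (hball δ hδ g x y) (inv_nonneg.2 measureReal_nonneg)
  rw [← ENNReal.ofReal_mul (by positivity), ← ofReal_measureReal, ← ofReal_measureReal,
    ← ENNReal.ofReal_add measureReal_nonneg (by positivity)]
  exact ENNReal.ofReal_le_ofReal hreal

theorem measurable_noise_smul_horizontalLine (δ : ℝ) (g : SO3) {B : Set PS2}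
    (hB : MeasurableSet B) : Measurable fun p => noise δ {u | (u * g) • horizontalLine p ∈ B} :=
  measurable_measure_prodMk_right (μ := noise δ)
    (((measurable_fst.mul_const g).smul (measurable_horizontalLine.comp measurable_snd)) hB)

theorem lintegral_noise_smul_horizontalLine {δ : ℝ} (hδ : 0 < δ) {B : Set PS2}
    (hB : MeasurableSet B) :
    ∫⁻ g, ∫⁻ p, noise δ {u | (u * g) • horizontalLine p ∈ B} ∂area ∂haarSO3 = liouville B := by
  have := isProbabilityMeasure_noise hδ
  rw [liouville_eq_map_frameLine]
  exact lintegral_lintegral_smul_mem haarSO3 (noise δ) area measurable_horizontalLine _ hB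

theorem lintegral_twistS2_framePoint_frameLimit (ε : ℝ) {δ : ℝ} (hδ : 0 < δ) (g : SO3)
    {F : S2 → ℝ≥0∞} (hF : Measurable F) :
    ∫⁻ a, F (twistS2 ε (framePoint a)) ∂frameLimit ε hδ g = ∫⁻ p, F p ∂area := by
  have htwist := (continuous_twistS2 ε).measurable
  conv_rhs => rw [← map_twistS2_area ε, lintegral_map hF htwist, ← map_framePoint_frameLimit ε hδ g]
  exact (lintegral_map (hF.comp htwist) continuous_framePoint.measurable).symm

theorem lintegral_weight_firstRow_frameLimit_le (ε : ℝ) {δ : ℝ} (hδ : 0 < δ) (g : SO3) :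
    ∫⁻ a, weight (firstRow a) ∂frameLimit ε hδ g ≤
      (haarSO3 (rotationBall δ))⁻¹ * ∫⁻ a, weight (firstRow a) ∂haarSO3 := by
  refine (lintegral_mono' (frameLimit_le ε hδ g) le_rfl).trans_eq ?_
  rw [lintegral_smul_measure, smul_eq_mul]

/-- By stationarity the frame may be twisted and then diffused once more. In this step, replacing
the twisted frame by the nearest horizontal one costs the square root of their distance, and the
law of the horizontal line at the twisted point is explicit since the base points are uniformly
distributed. -/
theorem exists_frameLimit_preimage_frameLine_le : ∃ C : ℝ, 0 < C ∧
    ∀ {ε δ : ℝ} (_ : 0 < ε) (hδ : 0 < δ) (g : SO3) {B : Set PS2}, MeasurableSet B →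
      frameLimit ε hδ g (frameLine ⁻¹' B) ≤
        ∫⁻ p, noise δ {u | (u * g) • horizontalLine p ∈ B} ∂area +
          ENNReal.ofReal (C * (haarSO3.real (rotationBall δ))⁻¹ * ε ^ (-(1 / 2) : ℝ)) *
            ∫⁻ a, weight (firstRow a) ∂frameLimit ε hδ g := by
  obtain ⟨C, hC, hnoise⟩ := exists_noise_mul_mem_le
  refine ⟨3 * C, by positivity, fun {ε δ} hε hδ g B hB => ?_⟩
  set D := ENNReal.ofReal (3 * C * (haarSO3.real (rotationBall δ))⁻¹ * ε ^ (-(1 / 2) : ℝ)) with hD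
  have hline := continuous_frameLine.measurable hB
  have hweight : Measurable fun a => weight (firstRow a) :=
    measurable_weight.comp measurable_firstRow
  have hpointwise (a : SO3) : noise δ {u | u * (g * twistFrame ε a) ∈ frameLine ⁻¹' B} ≤
      noise δ {u | (u * g) • horizontalLine (twistS2 ε (framePoint a)) ∈ B} +
        D * weight (firstRow a) := by
    refine (hnoise δ hδ g (twistFrame ε a) (horizontalFrame ε a) _ hline).trans ?_
    refine add_le_add (le_of_eq ?_) ?_
    · simp only [← frameLine_horizontalFrame, frameLine, mul_smul, Set.mem_preimage]
    · refine (mul_le_mul_right (ofReal_sqrt_frameGap_horizontalFrame_le hε a) _).trans_eq ?_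
      rw [hD, ← mul_assoc, ← ENNReal.ofReal_mul (by positivity)]
      ring_nf
  rw [← stepFrame_frameLimit, stepFrame_apply _ _ _ _ hline]
  refine (lintegral_mono hpointwise).trans_eq ?_
  rw [lintegral_add_right _ (hweight.const_mul D), lintegral_const_mul _ hweight,
    lintegral_twistS2_framePoint_frameLimit ε hδ g (measurable_noise_smul_horizontalLine δ g hB),
    stepFrame_frameLimit]

theorem exists_averagedMeasure_le_add : ∃ C : ℝ, 0 < C ∧ ∀ {ε δ : ℝ}, 0 < ε → 0 < δ →
    ∀ {B : Set PS2}, MeasurableSet B → averagedMeasure ε δ B ≤ liouville B +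
      ENNReal.ofReal (C * (haarSO3.real (rotationBall δ) ^ 2)⁻¹ * ε ^ (-(1 / 2) : ℝ)) := by
  obtain ⟨C, hC, hbound⟩ := exists_frameLimit_preimage_frameLine_le
  set K : ℝ≥0∞ := ∫⁻ a, weight (firstRow a) ∂haarSO3
  have hK : K ≠ ∞ := lintegral_weight_firstRow_lt_top.ne
  refine ⟨C * (K.toReal + 1), by positivity, fun {ε δ} hε hδ B hB => ?_⟩
  have hball := haarSO3_real_rotationBall_pos hδ
  set U := haarSO3.real (rotationBall δ) with hU
  have herror : ENNReal.ofReal (C * U⁻¹ * ε ^ (-(1 / 2) : ℝ)) *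
      ((haarSO3 (rotationBall δ))⁻¹ * K) ≤
        ENNReal.ofReal (C * (K.toReal + 1) * (U ^ 2)⁻¹ * ε ^ (-(1 / 2) : ℝ)) := by
    have := Real.rpow_pos_of_pos hε (-(1 / 2))
    rw [← ENNReal.ofReal_toReal hK, ← ofReal_measureReal, ← hU, ← ENNReal.ofReal_inv_of_pos hball,
      ← ENNReal.ofReal_mul (by positivity), ← ENNReal.ofReal_mul (by positivity),
      ENNReal.toReal_ofReal ENNReal.toReal_nonneg]
    refine ENNReal.ofReal_le_ofReal ?_
    calc C * U⁻¹ * ε ^ (-(1 / 2) : ℝ) * (U⁻¹ * K.toReal)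
        = C * K.toReal * (U ^ 2)⁻¹ * ε ^ (-(1 / 2) : ℝ) := by ring
      _ ≤ C * (K.toReal + 1) * (U ^ 2)⁻¹ * ε ^ (-(1 / 2) : ℝ) := by
        gcongr
        exact le_add_of_nonneg_right zero_le_one
  calc averagedMeasure ε δ B = ∫⁻ g, frameLimit ε hδ g (frameLine ⁻¹' B) ∂haarSO3 :=
        averagedMeasure_apply ε hδ hB
    _ ≤ ∫⁻ g, (∫⁻ p, noise δ {u | (u * g) • horizontalLine p ∈ B} ∂area +
          ENNReal.ofReal (C * (K.toReal + 1) * (U ^ 2)⁻¹ * ε ^ (-(1 / 2) : ℝ))) ∂haarSO3 :=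
        lintegral_mono fun g => (hbound hε hδ g hB).trans <| add_le_add_right
          ((mul_le_mul_right (lintegral_weight_firstRow_frameLimit_le ε hδ g) _).trans herror) _
    _ = _ := by
        rw [lintegral_add_right _ measurable_const, lintegral_noise_smul_horizontalLine hδ hB]
        simp only [lintegral_const, measure_univ, mul_one]

theorem exists_averagedMeasure_le : ∃ C : ℝ, 0 < C ∧ ∀ {ε δ : ℝ}, 0 < ε → 0 < δ → δ ≤ Real.pi →
    ∀ {B : Set PS2}, MeasurableSet B → averagedMeasure ε δ B ≤
      liouville B + ENNReal.ofReal (C * (δ ^ 6)⁻¹ * ε ^ (-(1 / 2) : ℝ)) := by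
  obtain ⟨C, hC, hbound⟩ := exists_averagedMeasure_le_add
  obtain ⟨c, hc, hball⟩ := exists_le_haarSO3_rotationBall
  refine ⟨C * (c ^ 2)⁻¹, by positivity, fun {ε δ} hε hδ hδπ B hB =>
    (hbound hε hδ hB).trans (add_le_add_right (ENNReal.ofReal_le_ofReal ?_) _)⟩
  calc C * (haarSO3.real (rotationBall δ) ^ 2)⁻¹ * ε ^ (-(1 / 2) : ℝ)
      ≤ C * ((c * δ ^ 3) ^ 2)⁻¹ * ε ^ (-(1 / 2) : ℝ) := by
        gcongr
        exact hball δ hδ hδπ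
    _ = C * (c ^ 2)⁻¹ * (δ ^ 6)⁻¹ * ε ^ (-(1 / 2) : ℝ) := by ring

theorem averagedMeasure_le_of_pi_lt (ε : ℝ) {δ : ℝ} (hδ : Real.pi < δ) {B : Set PS2}
    (hB : MeasurableSet B) : averagedMeasure ε δ B ≤ liouville B := by
  have hδ0 := Real.pi_pos.trans hδ
  rw [averagedMeasure_apply ε hδ0 hB, liouville_eq_map_frameLine,
    Measure.map_apply continuous_frameLine.measurable hB]
  refine (lintegral_mono fun g => frameLimit_le ε hδ0 g _).trans ?_
  simp [rotationBall_eq_univ hδ]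

/-! ### Densities -/

section RadonNikodym

variable {X : Type*} [MeasurableSpace X] {P m : Measure X}

/-- As `P` and `m` have the same mass, the integral of `|dP/dm - 1|` is twice the integral of
`dP/dm - 1` over the set where it is positive. -/
theorem integral_abs_rnDeriv_sub_one_le [IsProbabilityMeasure P] [IsProbabilityMeasure m]
    (hP : P ≪ m) {E : ℝ} (hE : 0 ≤ E)
    (h : ∀ B, MeasurableSet B → P B ≤ m B + ENNReal.ofReal E) :
    ∫ x, |(P.rnDeriv m x).toReal - 1| ∂m ≤ 2 * E := by
  set f : X → ℝ := fun x => (P.rnDeriv m x).toReal with hf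
  have hint : Integrable f m := Measure.integrable_toReal_rnDeriv
  have hsub : Integrable (fun x => f x - 1) m := hint.sub (integrable_const 1)
  set B : Set X := {x | 1 ≤ f x}
  have hB : MeasurableSet B :=
    measurableSet_le measurable_const (Measure.measurable_rnDeriv P m).ennreal_toReal
  have habs (x : X) : |f x - 1| = 2 * B.indicator (fun x => f x - 1) x - (f x - 1) := by
    by_cases hx : x ∈ B
    · rw [Set.indicator_of_mem hx, abs_of_nonneg (sub_nonneg.2 hx)]
      ring
    · rw [Set.indicator_of_notMem hx, abs_of_neg (sub_neg.2 (not_le.1 hx))]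
      ring
  have htotal : ∫ x, (f x - 1) ∂m = 0 := by
    rw [integral_sub hint (integrable_const 1), hf, Measure.integral_toReal_rnDeriv hP,
      integral_const, probReal_univ, probReal_univ, one_smul, sub_self]
  have hpositive : ∫ x in B, (f x - 1) ∂m ≤ E := by
    rw [integral_sub hint.integrableOn (integrable_const 1), hf,
      Measure.setIntegral_toReal_rnDeriv hP, setIntegral_const, smul_eq_mul, mul_one,
      sub_le_iff_le_add']
    have hreal := ENNReal.toReal_mono (by finiteness) (h B hB)
    rwa [ENNReal.toReal_add (by finiteness) (by finiteness), ENNReal.toReal_ofReal hE] at hreal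
  calc ∫ x, |f x - 1| ∂m = 2 * ∫ x in B, (f x - 1) ∂m := by
        simp only [habs]
        rw [integral_sub ((hsub.indicator hB).const_mul 2) hsub, integral_const_mul,
          integral_indicator hB, htotal, sub_zero]
    _ ≤ 2 * E := by gcongr

theorem eLpNorm_one_rnDeriv_sub_one [IsFiniteMeasure P] [IsFiniteMeasure m] :
    eLpNorm (fun x => (P.rnDeriv m x).toReal - 1) 1 m =
      ENNReal.ofReal (∫ x, |(P.rnDeriv m x).toReal - 1| ∂m) := by
  rw [eLpNorm_one_eq_lintegral_enorm]
  exact (ofReal_integral_norm_eq_lintegral_enorm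
    (Measure.integrable_toReal_rnDeriv.sub (integrable_const 1))).symm

theorem abs_integral_sub_le_norm_mul_integral_abs_rnDeriv_sub_one [TopologicalSpace X]
    [OpensMeasurableSpace X] [IsFiniteMeasure P] [IsFiniteMeasure m] (hP : P ≪ m) (F : X →ᵇ ℝ) :
    |∫ x, F x ∂P - ∫ x, F x ∂m| ≤ ‖F‖ * ∫ x, |(P.rnDeriv m x).toReal - 1| ∂m := by
  have hdensity : Integrable (fun x => (P.rnDeriv m x).toReal) m :=
    Measure.integrable_toReal_rnDeriv
  have hmul : Integrable (fun x => (P.rnDeriv m x).toReal * F x) m :=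
    hdensity.mul_bdd F.continuous.measurable.aestronglyMeasurable
      (ae_of_all _ F.norm_coe_le_norm)
  rw [← integral_rnDeriv_smul hP, ← integral_const_mul, ← Real.norm_eq_abs]
  simp only [smul_eq_mul]
  rw [← integral_sub hmul (F.integrable m)]
  refine norm_integral_le_of_norm_le ((hdensity.sub (integrable_const 1)).abs.const_mul _)
    (ae_of_all _ fun x => ?_)
  rw [← sub_one_mul, norm_mul, mul_comm]
  exact mul_le_mul_of_nonneg_right (F.norm_coe_le_norm x) (norm_nonneg _)

end RadonNikodym

theorem exists_integral_abs_density_sub_one_lt : ∃ C : ℝ, 0 < C ∧ ∀ ε δ : ℝ, 0 < ε → 0 < δ →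
    ∫ x, |density ε δ x - 1| ∂liouville < C * δ ^ (-11 : ℤ) * ε ^ (-(1 / 2) : ℝ) := by
  obtain ⟨C, hC, hle⟩ := exists_averagedMeasure_le
  refine ⟨2 * C * Real.pi ^ 5 + 1, by positivity, fun ε δ hε hδ => ?_⟩
  have := isProbabilityMeasure_averagedMeasure ε hδ
  have hrate : 0 < δ ^ (-11 : ℤ) * ε ^ (-(1 / 2) : ℝ) :=
    mul_pos (zpow_pos hδ _) (Real.rpow_pos_of_pos hε _)
  have hac := averagedMeasure_absolutelyContinuous ε hδ
  rcases le_or_gt δ Real.pi with hδπ | hδπ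
  · have hpow : (δ ^ 6)⁻¹ ≤ Real.pi ^ 5 * δ ^ (-11 : ℤ) := by
      calc (δ ^ 6)⁻¹ = δ ^ 5 * δ ^ (-11 : ℤ) := by field_simp
        _ ≤ Real.pi ^ 5 * δ ^ (-11 : ℤ) := by gcongr
    calc ∫ x, |density ε δ x - 1| ∂liouville ≤ 2 * (C * (δ ^ 6)⁻¹ * ε ^ (-(1 / 2) : ℝ)) :=
          integral_abs_rnDeriv_sub_one_le hac (by positivity) fun B => hle hε hδ hδπ
      _ ≤ 2 * (C * (Real.pi ^ 5 * δ ^ (-11 : ℤ)) * ε ^ (-(1 / 2) : ℝ)) := by gcongr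
      _ < (2 * C * Real.pi ^ 5 + 1) * δ ^ (-11 : ℤ) * ε ^ (-(1 / 2) : ℝ) := by linarith
  · calc ∫ x, |density ε δ x - 1| ∂liouville ≤ 2 * 0 :=
          integral_abs_rnDeriv_sub_one_le hac le_rfl fun B hB => by
            simpa using averagedMeasure_le_of_pi_lt ε hδπ hB
      _ < (2 * C * Real.pi ^ 5 + 1) * δ ^ (-11 : ℤ) * ε ^ (-(1 / 2) : ℝ) := by
          rw [mul_zero, mul_assoc]
          positivity

theorem tendsto_integral_averagedMeasure {δ : ℝ} (hδ : 0 < δ) (F : PS2 →ᵇ ℝ) :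
    Tendsto (fun ε => ∫ x, F x ∂averagedMeasure ε δ) atTop (𝓝 (∫ x, F x ∂liouville)) := by
  obtain ⟨C, -, hlt⟩ := exists_integral_abs_density_sub_one_lt
  rw [tendsto_iff_norm_sub_tendsto_zero]
  have hrate : Tendsto (fun ε : ℝ => ‖F‖ * (C * δ ^ (-11 : ℤ) * ε ^ (-(1 / 2) : ℝ))) atTop
      (𝓝 0) := by
    simpa only [mul_zero] using ((tendsto_rpow_neg_atTop (y := 1 / 2) (by norm_num)).const_mul
      (C * δ ^ (-11 : ℤ))).const_mul ‖F‖
  refine squeeze_zero' (Eventually.of_forall fun _ => norm_nonneg _) ?_ hrate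
  filter_upwards [eventually_gt_atTop 0] with ε hε
  have := isProbabilityMeasure_averagedMeasure ε hδ
  exact (abs_integral_sub_le_norm_mul_integral_abs_rnDeriv_sub_one
    (averagedMeasure_absolutelyContinuous ε hδ) F).trans
      (mul_le_mul_of_nonneg_left (hlt ε δ hε hδ).le (norm_nonneg _))

end TwistSphere

end

theorem mainTheorem1 :
    (∃ C : ℝ, 0 < C ∧ ∀ ε δ : ℝ, 0 < ε → 0 < δ →
      (∀ g : TwistSphere.SO3,
        TwistSphere.IsDiffusedStationary ε δ g (TwistSphere.diffusedMeasure ε δ g)) ∧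
      IsProbabilityMeasure (TwistSphere.averagedMeasure ε δ) ∧
      TwistSphere.averagedMeasure ε δ ≪ TwistSphere.liouville ∧
      eLpNorm (fun x => TwistSphere.density ε δ x - 1) 1 TwistSphere.liouville <
        ENNReal.ofReal (C * δ ^ (-11 : ℤ) * ε ^ (-(1 / 2) : ℝ))) ∧
    ∀ δ : ℝ, 0 < δ → ∀ F : TwistSphere.PS2 →ᵇ ℝ,
      Tendsto (fun ε => ∫ x, F x ∂(TwistSphere.averagedMeasure ε δ)) atTop
        (𝓝 (∫ x, F x ∂TwistSphere.liouville)) := by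
  refine ⟨?_, fun δ hδ F => TwistSphere.tendsto_integral_averagedMeasure hδ F⟩
  obtain ⟨C, hC, hlt⟩ := TwistSphere.exists_integral_abs_density_sub_one_lt
  refine ⟨C, hC, fun ε δ hε hδ => ?_⟩
  have hprobability := TwistSphere.isProbabilityMeasure_averagedMeasure ε hδ
  refine ⟨TwistSphere.isDiffusedStationary ε hδ, hprobability,
    TwistSphere.averagedMeasure_absolutelyContinuous ε hδ, ?_⟩
  calc _ = ENNReal.ofReal (∫ x, |TwistSphere.density ε δ x - 1| ∂TwistSphere.liouville) :=
        TwistSphere.eLpNorm_one_rnDeriv_sub_one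
    _ < ENNReal.ofReal (C * δ ^ (-11 : ℤ) * ε ^ (-(1 / 2) : ℝ)) :=
        (ENNReal.ofReal_lt_ofReal_iff_of_nonneg (integral_nonneg fun _ => abs_nonneg _)).2
          (hlt ε δ hε hδ)
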